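/- Let $G$ be a finite weighted bipartite graph with vertex classes $A,B$, edge weights $w_e>0$, total weight $W=\sum_e w_e$, a starting vertex $s\in A$ and a set $M$ of marked vertices with $s\notin M$. A unit flow from $s$ to $M$ is an assignment of real numbers $p_e$ to the edges (directed from $A$ to $B$) such that for every vertex $x\notin M$ the sum of $p_e$ over the edges $e$ at $x$ is $1$ if $x=s$ and $0$ otherwise. Assume that a unit flow exists, and let the effective resistance $R_{s,M}$ be the minimum of the energy $\sum_e p_e^2/w_e$ over all unit flows. For $\eta>0$ let $G'_\eta$ be the graph obtained from $G$ by adding a vertex $s'$ to $B$ and an edge $s's$ of weight $1/\eta$. Its quantum walk operator is $U_AU_B$, acting on the space with one basis state $|xy\rangle$ for each edge $xy$ of $G'_\eta$, where $U_A=\bigoplus_{x\in A}D_x$ and $U_B=\bigoplus_{x\in B\cup\{s'\}}D_x$. Here $D_x$ is the identity if $x\in M\cup\{s'\}$, and otherwise $D_x=I-2|\psi_x\rangle\langle\psi_x|$ with $|\psi_x\rangle=d_x^{-1/2}\sum_{y}\sqrt{w_{xy}}\,|xy\rangle$ and $d_x=\sum_y w_{xy}$. A quantum walk step is one application of $U_AU_B$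 or of its inverse, possibly controlled by the workspace of the algorithm, for a value of $\eta$ chosen by the algorithm. Besides quantum walk steps the algorithm may prepare the state $|s's\rangle$, apply arbitrary unitaries to its workspace (also controlled on whether the walk register is in the state $|s's\rangle$), measure the workspace, and choose its further actions and its output from the outcomes. It has no other access to $G$, $s$ and $M$. There is a universal constant $C$ such that for every real $\tilde W$ and every $\epsilon>0$ there is such a quantum algorithm, depending only on $\tilde W$ and $\epsilon$, with the following property. For all $G$, $s$, $M$ as above with $W\le\tilde W$, with probability at least $2/3$ the algorithm stops with an output $r$ such that $|r-R_{s,M}|\le\epsilon R_{s,M}$ after a total of at most \[ C\,\frac{\sqrt{R_{s,M}\tilde W}}{\epsilon^2} \] quantum walk steps. -/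

import Mathlib

open scoped Matrix

universe u v w

noncomputable section

/-- A weighted bipartite graph with vertex classes `A`, `B` and edge set `E`: the edge `e` joins
`src e ∈ A` to `tgt e ∈ B` and has weight `wt e > 0`. (Parallel edges are not excluded.) -/
structure Network (A : Type u) (B : Type v) (E : Type w) where
  src : E → A
  tgt : E → B
  wt : E → ℝ
  wt_pos : ∀ e, 0 < wt e

namespace Network

variable {A : Type u} {B : Type v} {E : Type w} [Fintype E]

/-- The edge `e` is incident to the vertex `x`. -/
def Inc (N : Network A B E) : A ⊕ B → E → Prop
  | .inl a, e => N.src e = a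
  | .inr b, e => N.tgt e = b

/-- The total weight, the sum of all edge weights. -/
def totalWeight (N : Network A B E) : ℝ := ∑ e, N.wt e

open Classical in
/-- The weighted degree of a vertex. -/
def deg (N : Network A B E) (x : A ⊕ B) : ℝ := ∑ e, if N.Inc x e then N.wt e else 0

open Classical in
/-- `p` is a unit flow from `s ∈ A` to the set `M`. Edges are directed from `A` to `B`. At every
vertex outside `M` the sum of the flow over the incident edges is `1` at `s` and `0` elsewhere. -/
def IsUnitFlow (N : Network A B E) (s : A) (M : Set (A ⊕ B)) (p : E → ℝ) : Prop :=
  ∀ x : A ⊕ B, x ∉ M →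
    (∑ e, if N.Inc x e then p e else 0) = if x = Sum.inl s then 1 else 0

/-- The energy of a flow, where the edge `e` has resistance `1 / wt e`. -/
def energy (N : Network A B E) (p : E → ℝ) : ℝ := ∑ e, p e ^ 2 / N.wt e

/-- The effective resistance between `s` and `M`: the least energy of a unit flow. -/
def effRes (N : Network A B E) (s : A) (M : Set (A ⊕ B)) : ℝ :=
  sInf {r | ∃ p, N.IsUnitFlow s M p ∧ r = N.energy p}

/-! ### The quantum walk operator, on the space with one basis state for each edge -/

open Classical in
/-- The normalised star state of the vertex `x`,
`(deg x)^(-1/2) * ∑ sqrt (wt e) |e⟩` over the edges `e` at `x`. -/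
def starState (N : Network A B E) (x : A ⊕ B) (e : E) : ℂ :=
  if N.Inc x e then ((Real.sqrt (N.wt e) / Real.sqrt (N.deg x) : ℝ) : ℂ) else 0

open Classical in
/-- The diffusion at `x`: the identity for `x` in `T`, the reflection `1 - 2|ψ⟩⟨ψ|` in the star
state `ψ` of `x` otherwise. -/
def diffusion (N : Network A B E) (T : Set (A ⊕ B)) (x : A ⊕ B) : Matrix E E ℂ :=
  if x ∈ T then 1 else 1 - 2 • Matrix.vecMulVec (N.starState x) (star (N.starState x))

open Classical in
/-- The direct sum of the diffusions at the vertices of `A`. -/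
def reflA (N : Network A B E) (T : Set (A ⊕ B)) : Matrix E E ℂ :=
  Matrix.of fun e f =>
    if N.src e = N.src f then N.diffusion T (Sum.inl (N.src e)) e f else 0

open Classical in
/-- The direct sum of the diffusions at the vertices of `B`. -/
def reflB (N : Network A B E) (T : Set (A ⊕ B)) : Matrix E E ℂ :=
  Matrix.of fun e f =>
    if N.tgt e = N.tgt f then N.diffusion T (Sum.inr (N.tgt e)) e f else 0

/-- The quantum walk operator `U_A U_B` of a graph with marked set `M` and starting vertex
`s ∈ B`; the diffusion is trivial on `M` and at `s`. -/
def walkOp (N : Network A B E) (M : Set (A ⊕ B)) (s : B) : Matrix E E ℂ :=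
  N.reflA (M ∪ {Sum.inr s}) * N.reflB (M ∪ {Sum.inr s})

/-- The augmented graph: a new vertex `s' = none` in the class `B`, joined to `s ∈ A` by one new
edge `none` of weight `1 / η`. -/
def augment (N : Network A B E) (s : A) (η : Set.Ioi (0 : ℝ)) :
    Network A (Option B) (Option E) where
  src e := e.elim s N.src
  tgt e := e.map N.tgt
  wt e := e.elim (1 / (η : ℝ)) N.wt
  wt_pos e := by
    cases e with
    | none => exact one_div_pos.mpr η.2
    | some e => exact N.wt_pos e

/-- The quantum walk operator of the augmented graph, with the marked set `M` and the starting
vertex `s'`: one quantum walk step. -/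
def walkStep (N : Network A B E) (s : A) (M : Set (A ⊕ B)) (η : Set.Ioi (0 : ℝ)) :
    Matrix (Option E) (Option E) ℂ :=
  (N.augment s η).walkOp (Sum.map id some '' M) none

end Network

/-! ### Quantum algorithms that use the quantum walk operator as a black box

Nothing in the description of an algorithm refers to a graph: the graph, its starting vertex and
its marked set enter only through the walk operator and through the basis state `|s's⟩`. -/

/-- A gate on the edge register of the augmented graph together with a work register with basis
`Fin (k + 1)`.
* `work V₀ V₁` applies `V₁` to the work register if the edge register is in the basis state
  `|s's⟩`, and `V₀` if it is in an orthogonal state. (So `V₀ = V₁` is a unitary of the work register,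
  and the reflection in the initial state is a gate of this kind.)
* `walk η S` applies the quantum walk operator of the augmented graph with parameter `η`,
  controlled on the work register being in one of the basis states in `S`.
* `walkInv η S` does the same with the inverse of the walk operator. -/
inductive Gate (k : ℕ) : Type
  | work (V₀ V₁ : Matrix.unitaryGroup (Fin (k + 1)) ℂ)
  | walk (η : Set.Ioi (0 : ℝ)) (S : Finset (Fin (k + 1)))
  | walkInv (η : Set.Ioi (0 : ℝ)) (S : Finset (Fin (k + 1)))

namespace Gate

/-- The number of quantum walk steps of a gate. -/
def steps {k : ℕ} : Gate k → ℕ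
  | work _ _ => 0
  | walk _ _ => 1
  | walkInv _ _ => 1

open Classical in
/-- `U` on the edge register, controlled on the work register being in `S`. -/
def controlled {k : ℕ} {F : Type w} (S : Finset (Fin (k + 1))) (U : Matrix F F ℂ) :
    Matrix (F × Fin (k + 1)) (F × Fin (k + 1)) ℂ :=
  Matrix.of fun p q =>
    if p.2 = q.2 then (if p.2 ∈ S then U p.1 q.1 else (1 : Matrix F F ℂ) p.1 q.1) else 0

open Classical in
/-- The operator that a gate applies, for a given graph, starting vertex and marked set. The basis
state `none` of the edge register is `|s's⟩`. -/
def op {k : ℕ} {A : Type u} {B : Type v} {E : Type w} [Fintype E]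
    (N : Network A B E) (s : A) (M : Set (A ⊕ B)) :
    Gate k → Matrix (Option E × Fin (k + 1)) (Option E × Fin (k + 1)) ℂ
  | work V₀ V₁ => Matrix.of fun p q =>
      if p.1 = q.1 then
        (if p.1 = none then V₁.1 p.2 q.2 else V₀.1 p.2 q.2)
      else 0
  | walk η S => controlled S (N.walkStep s M η)
  | walkInv η S => controlled S (N.walkStep s M η)ᴴ

end Gate

/-- A quantum circuit: a size of the work register and a list of gates, applied in this order. -/
structure Circuit where
  k : ℕ
  gates : List (Gate k)

namespace Circuit

/-- The number of quantum walk steps of a circuit. -/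
def steps (C : Circuit) : ℕ := (C.gates.map Gate.steps).sum

variable {A : Type u} {B : Type v} {E : Type w} [Fintype E]

open Classical in
/-- The final state of a circuit that is started in `|s's⟩ |0⟩`. -/
def finalState (C : Circuit) (N : Network A B E) (s : A) (M : Set (A ⊕ B)) :
    Option E × Fin (C.k + 1) → ℂ :=
  C.gates.foldl (fun ψ g => (g.op N s M) *ᵥ ψ) (Pi.single (none, 0) 1)

/-- The probability that a measurement of the work register at the end gives `i`. -/
def outcomeProb (C : Circuit) (N : Network A B E) (s : A) (M : Set (A ⊕ B))
    (i : Fin (C.k + 1)) : ℝ :=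
  ∑ e, ‖C.finalState N s M (e, i)‖ ^ 2

end Circuit

/-- What an algorithm does next: stop with a real number as its output, or run a circuit from the
initial state and measure the work register. -/
inductive NextAction : Type
  | output (r : ℝ)
  | run (C : Circuit)

/-- A quantum algorithm: a classical control that chooses the next action from the list of all
measurement outcomes so far (the latest one first). -/
def QAlgorithm : Type := List ℕ → NextAction

namespace QAlgorithm

variable {A : Type u} {B : Type v} {E : Type w} [Fintype E]

open Classical in
/-- The probability that the algorithm, after the outcomes `h` and `t` quantum walk steps, stops
within `n` more runs of circuits, with an output `r` and a total number `T` of quantum walk steps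
(all runs together) such that `P r T` holds. -/
def haltProb (alg : QAlgorithm) (N : Network A B E) (s : A) (M : Set (A ⊕ B))
    (P : ℝ → ℕ → Prop) : ℕ → List ℕ → ℕ → ℝ
  | 0, h, t =>
    match alg h with
    | .output r => if P r t then 1 else 0
    | .run _ => 0
  | n + 1, h, t =>
    match alg h with
    | .output r => if P r t then 1 else 0
    | .run C => ∑ i : Fin (C.k + 1),
        C.outcomeProb N s M i * haltProb alg N s M P n (i.val :: h) (t + C.steps)

end QAlgorithm

end

/-! Write `h = √η`, `ψ` for the initial state, `R` for the effective resistance and `X = U_A U_B`.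
Everything about the walk comes from a few explicit vectors; no spectral analysis is needed. Let `u`
be the equilibrium potential, equal to `1` at `s` and to `0` on `M` and at `s'`. Scaling by `√w` the
values of `u` at the two ends of each edge gives vectors `α`, `β`, which `U_A` and `U_B`
respectively negate, and `α - β = f + ψ/h` with `f = √w · grad u`. The optimal unit flow, continued
along the new edge, gives `φ = R f - h ψ`, which both reflections fix (`exists_walkData`).

Estimation. `ψ` splits orthogonally as `g + (y - X y)` with `g` a multiple of `φ` and `‖g‖² =
η/(η+R)` (`exists_decomp`). The average of the first `T` powers of `X` fixes `g` and shrinks a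
coboundary `y - X y` like `1/T`. So the squared norm of the averaged `ψ`, an outcome probability of
a circuit with fewer than `T` walk steps, lies between `η/(η+R)` and `η/(η+R) + (ηW+1)/T²`
(`avgProb_false_bounds`). For `η` of order `R` this determines `R`.

Sampling only at a `T` with bias of order `ε` would cost more than `1/ε²`. By the parallelogram law
the drop of the probability from `T` to `2T` is again an outcome probability (`norm_powAvg_sq_sub`),
so a multilevel estimator applies. At depth `i` the drop is `O(4^{-i})` and a run costs `O(2^i)`, so
sample numbers proportional to `3^{-i}` make both the variance and the leading part of the cost
geometric series.

Scale. A suitable `η` must be found first. With a sign flip of `ψ` before each step, `ψ` itself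
becomes a coboundary, and its averages vanish once `T` is large compared with `√R/h`. For `T` small
compared with `√R/h`, and `h√W` small, `ψ` is almost fixed (`norm_powAvg_le`, `le_norm_powAvg`).
With `h` a small constant over `√W'`, the drop therefore happens within a constant factor of `√(R
W')`. A doubling search detects it (`exists_le_value_search`): the drop probabilities telescope, so
all false alarms at smaller scales together are rare. -/

namespace Network

/-! ### Equilibrium potentials and unit flows -/

variable {A : Type u} {B : Type v} {E : Type w} [Fintype E]

/-- The potential difference along an edge, directed from `A` to `B`. -/
def grad (N : Network A B E) (u : A ⊕ B → ℝ) (e : E) : ℝ :=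
  u (Sum.inl (N.src e)) - u (Sum.inr (N.tgt e))

open Classical in
theorem sum_mul_comp_eq_zero {F ι : Type*} [Fintype F] (κ : F → ι) (p : F → ℝ) (c : ι → ℝ)
    (h : ∀ i, c i * (∑ e, if κ e = i then p e else 0) = 0) :
    ∑ e, p e * c (κ e) = 0 := by
  rw [← Finset.sum_fiberwise_of_maps_to (s := Finset.univ) (t := Finset.univ.image κ) (g := κ)
    (fun e _ => Finset.mem_image_of_mem κ (Finset.mem_univ e))]
  refine Finset.sum_eq_zero fun i _ => ?_
  rw [← h i, Finset.sum_filter, Finset.mul_sum]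
  refine Finset.sum_congr rfl fun e _ => ?_
  split_ifs with he
  · rw [he, mul_comm]
  · simp

open Classical in
-- Summation by parts. Regrouped by vertices, the sum keeps only the term at `s`: the potential
-- vanishes on `M`, and the flow is conserved elsewhere.
theorem sum_mul_grad (N : Network A B E) {s : A} {M : Set (A ⊕ B)} {p : E → ℝ} {u : A ⊕ B → ℝ}
    (hM : ∀ x ∈ M, u x = 0)
    (hp : ∀ x, x ∉ M → x ≠ Sum.inl s → (∑ e, if N.Inc x e then p e else 0) = 0) :
    ∑ e, p e * N.grad u e = u (Sum.inl s) * ∑ e, if N.Inc (Sum.inl s) e then p e else 0 := by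
  have hB : ∑ e, p e * u (Sum.inr (N.tgt e)) = 0 := by
    refine sum_mul_comp_eq_zero N.tgt p (fun b => u (Sum.inr b)) fun b => ?_
    by_cases hb : Sum.inr b ∈ M
    · simp [hM _ hb]
    · exact mul_eq_zero_of_right _ (hp _ hb (by simp))
  -- The value at `s` is replaced by `0`, so that every vertex of `A` contributes nothing; the
  -- missing term is put back in the next identity.
  have hA : ∑ e, p e * (if N.src e = s then 0 else u (Sum.inl (N.src e))) = 0 := by
    refine sum_mul_comp_eq_zero N.src p (fun a => if a = s then 0 else u (Sum.inl a)) fun a => ?_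
    by_cases ha : Sum.inl a ∈ M
    · simp [hM _ ha]
    · by_cases has : a = s
      · simp [has]
      · exact mul_eq_zero_of_right _ (hp _ ha (by simpa using has))
  have : ∑ e, p e * N.grad u e
      = ∑ e, p e * (if N.src e = s then 0 else u (Sum.inl (N.src e)))
        - ∑ e, p e * u (Sum.inr (N.tgt e))
        + u (Sum.inl s) * ∑ e, if N.Inc (Sum.inl s) e then p e else 0 := by
    rw [Finset.mul_sum, ← Finset.sum_sub_distrib, ← Finset.sum_add_distrib]
    refine Finset.sum_congr rfl fun e _ => ?_
    by_cases h : N.src e = s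
    · rw [if_pos h, if_pos (show N.Inc (Sum.inl s) e from h), grad, h]; ring
    · rw [if_neg h, if_neg (show ¬ N.Inc (Sum.inl s) e from h), grad]; ring
  rw [this, hA, hB]; ring

open Classical in
-- A minimiser of the Dirichlet energy over a product of points and intervals. The product is
-- compact even for infinitely many vertices, and the energy depends on finitely many coordinates.
-- Restricting the values to `[0, 1]` builds in the maximum principle; harmonicity survives because
-- the competitor, with one value replaced by the average of its neighbours, stays in the product.
theorem exists_harmonic (N : Network A B E) {s : A} {M : Set (A ⊕ B)} (hs : Sum.inl s ∉ M) :
    ∃ u : A ⊕ B → ℝ, u (Sum.inl s) = 1 ∧ (∀ x ∈ M, u x = 0) ∧ (∀ x, 0 ≤ u x ∧ u x ≤ 1) ∧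
      ∀ x, x ∉ M → x ≠ Sum.inl s →
        (∑ e, if N.Inc x e then N.wt e * N.grad u e else 0) = 0 := by
  set K : Set (A ⊕ B → ℝ) := Set.univ.pi fun x =>
    if x = Sum.inl s then {1} else if x ∈ M then {0} else Set.Icc 0 1 with hK
  have hKc : IsCompact K := by
    refine isCompact_univ_pi fun x => ?_
    split_ifs
    · exact isCompact_singleton
    · exact isCompact_singleton
    · exact isCompact_Icc
  have hKne : K.Nonempty := by
    refine ⟨fun x => if x = Sum.inl s then 1 else 0, fun x _ => ?_⟩
    dsimp only
    split_ifs <;> simp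
  obtain ⟨u, huK, hmin⟩ := hKc.exists_isMinOn hKne
    (f := fun u => ∑ e, N.wt e * N.grad u e ^ 2)
    (by unfold grad; fun_prop)
  have hus : u (Sum.inl s) = 1 := by simpa using huK (Sum.inl s) trivial
  have huM : ∀ x ∈ M, u x = 0 := by
    intro x hx
    have hxs : x ≠ Sum.inl s := fun h => hs (h ▸ hx)
    simpa [hxs, hx] using huK x trivial
  have hu : ∀ x, 0 ≤ u x ∧ u x ≤ 1 := by
    intro x
    have := huK x trivial
    dsimp only at this
    split_ifs at this with h1 h2
    · rw [Set.mem_singleton_iff.1 this]; norm_num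
    · rw [Set.mem_singleton_iff.1 this]; norm_num
    · exact this
  refine ⟨u, hus, huM, hu, fun x hxM hxs => ?_⟩
  set g := ∑ e, if N.Inc x e then N.wt e * N.grad u e else 0 with hg
  set d := ∑ e, if N.Inc x e then N.wt e else 0 with hd
  -- The sign with which `u x` enters the potential difference along an edge at `x`.
  let σ : ℝ := Sum.elim (fun _ => 1) (fun _ => -1) x
  have hσ : σ * σ = 1 := by rcases x with a | b <;> simp [σ]
  have hd0 : 0 ≤ d := Finset.sum_nonneg fun e _ => by
    split_ifs
    · exact (N.wt_pos e).le
    · exact le_rfl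
  rcases hd0.eq_or_lt with hd0 | hd0
  · have hz := (Finset.sum_eq_zero_iff_of_nonneg (fun e _ => by
      split_ifs
      · exact (N.wt_pos e).le
      · exact le_rfl)).1 hd0.symm
    refine Finset.sum_eq_zero fun e he => ?_
    have := hz e he
    split_ifs at this ⊢ with h
    · exact absurd this (N.wt_pos e).ne'
    · rfl
  have hgrad : ∀ t e, N.grad (Function.update u x (u x + t)) e
      = N.grad u e + if N.Inc x e then σ * t else 0 := by
    intro t e
    rcases x with a | b
    · by_cases h : N.src e = a
      · subst h; simp [grad, Inc, σ]; ring
      · simp [grad, Inc, h]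
    · by_cases h : N.tgt e = b
      · subst h; simp [grad, Inc, σ]; ring
      · simp [grad, Inc, h]
  -- `u x - σ * grad` is the potential at the other end of the edge.
  have hother : ∀ e, N.Inc x e → 0 ≤ u x - σ * N.grad u e ∧ u x - σ * N.grad u e ≤ 1 := by
    intro e he
    rcases x with a | b
    · have he : N.src e = a := he
      subst he
      simpa [grad, σ] using hu (Sum.inr (N.tgt e))
    · have he : N.tgt e = b := he
      subst he
      simpa [grad, σ] using hu (Sum.inl (N.src e))
  have havg : d * u x - σ * g = ∑ e, if N.Inc x e then N.wt e * (u x - σ * N.grad u e) else 0 := by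
    rw [hd, hg, Finset.sum_mul, Finset.mul_sum, ← Finset.sum_sub_distrib]
    refine Finset.sum_congr rfl fun e _ => ?_
    split_ifs <;> ring
  have havg0 : 0 ≤ d * u x - σ * g := by
    rw [havg]
    refine Finset.sum_nonneg fun e _ => ?_
    split_ifs with h
    · exact mul_nonneg (N.wt_pos e).le (hother e h).1
    · exact le_rfl
  have havg1 : d * u x - σ * g ≤ d := by
    rw [havg, hd]
    refine Finset.sum_le_sum fun e _ => ?_
    split_ifs with h
    · exact mul_le_of_le_one_right (N.wt_pos e).le (hother e h).2
    · exact le_rfl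
  -- This `t` moves `u x` to the weighted average of its neighbours and changes the energy by `-g² /
  -- d`, so minimality forces `g = 0`.
  set t := -(σ * g / d) with ht
  have hxt : u x + t = (d * u x - σ * g) / d := by rw [ht]; field_simp; ring
  have hmem : Function.update u x (u x + t) ∈ K := by
    intro y _
    by_cases hy : y = x
    · subst hy
      simp only [hxs, hxM, if_false, Function.update_self]
      rw [hxt]
      exact ⟨div_nonneg havg0 hd0.le, (div_le_one hd0).2 havg1⟩
    · rw [Function.update_of_ne hy]; exact huK y trivial
  have hle := isMinOn_iff.1 hmin _ hmem
  have hexp : ∑ e, N.wt e * N.grad (Function.update u x (u x + t)) e ^ 2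
      = ∑ e, N.wt e * N.grad u e ^ 2 + 2 * σ * t * g + t ^ 2 * d := by
    rw [hd, hg, Finset.mul_sum, Finset.mul_sum, ← Finset.sum_add_distrib,
      ← Finset.sum_add_distrib]
    refine Finset.sum_congr rfl fun e _ => ?_
    rw [hgrad]
    split_ifs
    · linear_combination (N.wt e * t ^ 2) * hσ
    · ring
  rw [hexp] at hle
  have : 2 * σ * t * g + t ^ 2 * d = - (g ^ 2 / d) := by
    rw [ht]; field_simp; linear_combination (-g ^ 2) * hσ
  have h2 : g ^ 2 / d ≤ 0 := by linarith
  have h3 : g ^ 2 ≤ 0 := by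
    by_contra hc
    exact absurd h2 (not_le.2 (div_pos (not_le.1 hc) hd0))
  exact pow_eq_zero_iff (two_ne_zero) |>.1 (le_antisymm h3 (sq_nonneg g))

open Classical in
/-- Dirichlet's and Thomson's principles: the equilibrium potential, its energy `1 / R` and the
unit flow of least energy that it drives. -/
theorem exists_potential (N : Network A B E) {s : A} {M : Set (A ⊕ B)} (hs : Sum.inl s ∉ M)
    (hflow : ∃ p, N.IsUnitFlow s M p) :
    ∃ u : A ⊕ B → ℝ, u (Sum.inl s) = 1 ∧ (∀ x ∈ M, u x = 0) ∧ (∀ x, 0 ≤ u x ∧ u x ≤ 1) ∧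
      0 < N.effRes s M ∧ ∑ e, N.wt e * N.grad u e ^ 2 = 1 / N.effRes s M ∧
      N.IsUnitFlow s M (fun e => N.effRes s M * (N.wt e * N.grad u e)) := by
  obtain ⟨u, hus, huM, hu, hharm⟩ := N.exists_harmonic hs
  set D := ∑ e, N.wt e * N.grad u e ^ 2 with hD
  have hD0 : 0 ≤ D := Finset.sum_nonneg fun e _ => mul_nonneg (N.wt_pos e).le (sq_nonneg _)
  have hdivs : (∑ e, if N.Inc (Sum.inl s) e then N.wt e * N.grad u e else 0) = D := by
    have := N.sum_mul_grad (s := s) huM hharm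
    rw [hus, one_mul] at this
    rw [← this]
    exact Finset.sum_congr rfl fun e _ => by ring
  have hpair : ∀ p, N.IsUnitFlow s M p → ∑ e, p e * N.grad u e = 1 := by
    intro p hp
    rw [N.sum_mul_grad (s := s) huM (fun x hx hxs => by rw [hp x hx, if_neg hxs]), hp _ hs, hus]
    simp
  -- Thomson's principle: Cauchy–Schwarz for the pairing of the flow with the gradient, which is `1`
  -- for every unit flow. The gradient flow attains equality.
  have hcs : ∀ p, N.IsUnitFlow s M p → 1 ≤ N.energy p * D := by
    intro p hp
    have h := Finset.sum_mul_sq_le_sq_mul_sq Finset.univ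
      (fun e => p e / Real.sqrt (N.wt e)) (fun e => Real.sqrt (N.wt e) * N.grad u e)
    have e1 : ∀ e, p e / Real.sqrt (N.wt e) * (Real.sqrt (N.wt e) * N.grad u e)
        = p e * N.grad u e := fun e => by
      have := (Real.sqrt_pos.2 (N.wt_pos e)).ne'
      field_simp
    simp only [e1, hpair p hp, div_pow, mul_pow, Real.sq_sqrt (N.wt_pos _).le] at h
    simpa [energy] using h
  have hDpos : 0 < D := by
    obtain ⟨p, hp⟩ := hflow
    rcases hD0.eq_or_lt with h | h
    · have := hcs p hp
      rw [← h] at this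
      norm_num at this
    · exact h
  have hunit : N.IsUnitFlow s M (fun e => 1 / D * (N.wt e * N.grad u e)) := by
    intro x hx
    have e1 : (∑ e, if N.Inc x e then 1 / D * (N.wt e * N.grad u e) else 0)
        = 1 / D * ∑ e, if N.Inc x e then N.wt e * N.grad u e else 0 := by
      rw [Finset.mul_sum]
      exact Finset.sum_congr rfl fun e _ => by split_ifs <;> simp
    rw [e1]
    split_ifs with h
    · rw [h, hdivs]; field_simp
    · rw [hharm x hx h, mul_zero]
  have hen : N.energy (fun e => 1 / D * (N.wt e * N.grad u e)) = 1 / D := by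
    have : N.energy (fun e => 1 / D * (N.wt e * N.grad u e)) = (1 / D) ^ 2 * D := by
      rw [energy, hD, Finset.mul_sum]
      refine Finset.sum_congr rfl fun e _ => ?_
      have := (N.wt_pos e).ne'
      field_simp
    rw [this]; field_simp
  have hR : N.effRes s M = 1 / D := by
    refine IsLeast.csInf_eq ⟨⟨_, hunit, hen.symm⟩, ?_⟩
    rintro r ⟨p, hp, rfl⟩
    rw [div_le_iff₀ hDpos]
    exact hcs p hp
  refine ⟨u, hus, huM, hu, ?_, ?_, ?_⟩
  · rw [hR]; positivity
  · rw [hR, one_div_one_div]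
  · rw [hR]; exact hunit

end Network

/-! ### Reflections in star states -/

section BlockReflection

variable {F ι : Type*} [Fintype F]

open Classical in
/-- The weight of the block `i`. -/
noncomputable def blockWeight (κ : F → ι) (w : F → ℝ) (i : ι) : ℝ := ∑ f, if κ f = i then w f else 0

open Classical in
/-- The unnormalised overlap of `v` with the star state of the block `i`. -/
noncomputable def starSum (κ : F → ι) (w : F → ℝ) (v : F → ℂ) (i : ι) : ℂ :=
  ∑ f, if κ f = i then (Real.sqrt (w f) : ℂ) * v f else 0

open Classical in
/-- The direct sum of the reflections in the star states of the blocks outside `T`. -/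
noncomputable def blockRefl (κ : F → ι) (w : F → ℝ) (T : Set ι) : Matrix F F ℂ :=
  Matrix.of fun e f =>
    if κ e = κ f then
      (if κ e ∈ T then (1 : Matrix F F ℂ) e f
        else (1 : Matrix F F ℂ) e f
          - 2 * ((Real.sqrt (w e) : ℂ) * Real.sqrt (w f) / blockWeight κ w (κ e)))
    else 0

theorem blockWeight_pos {κ : F → ι} {w : F → ℝ} (hw : ∀ e, 0 < w e) (e : F) :
    0 < blockWeight κ w (κ e) := by
  classical
  refine lt_of_lt_of_le (hw e) ?_
  have := Finset.single_le_sum (f := fun f => if κ f = κ e then w f else 0)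
    (fun f _ => by split_ifs; exacts [(hw f).le, le_rfl]) (Finset.mem_univ e)
  simpa [blockWeight] using this

open Classical in
theorem blockRefl_mulVec (κ : F → ι) (w : F → ℝ) (T : Set ι) (v : F → ℂ) (e : F) :
    (blockRefl κ w T *ᵥ v) e = v e - if κ e ∈ T then 0 else
      2 * Real.sqrt (w e) / blockWeight κ w (κ e) * starSum κ w v (κ e) := by
  have h1 : ∀ f, blockRefl κ w T e f * v f = (1 : Matrix F F ℂ) e f * v f
      - if κ e ∈ T then 0 else 2 * Real.sqrt (w e) / blockWeight κ w (κ e)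
        * (if κ f = κ e then (Real.sqrt (w f) : ℂ) * v f else 0) := by
    intro f
    rw [blockRefl, Matrix.of_apply]
    by_cases h : κ e = κ f
    · rw [if_pos h, if_pos h.symm]
      split_ifs
      · ring
      · ring
    · have hne : e ≠ f := fun h' => h (h' ▸ rfl)
      rw [if_neg h, if_neg (Ne.symm h), Matrix.one_apply_ne hne]
      split_ifs <;> ring
  rw [Matrix.mulVec, dotProduct, Finset.sum_congr rfl fun f _ => h1 f, Finset.sum_sub_distrib]
  congr 1
  · simp [Matrix.one_apply]
  · split_ifs
    · simp
    · rw [starSum, Finset.mul_sum]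

theorem blockRefl_mulVec_of_starSum {κ : F → ι} {w : F → ℝ} {T : Set ι} {v : F → ℂ}
    (h : ∀ i, i ∉ T → starSum κ w v i = 0) : blockRefl κ w T *ᵥ v = v := by
  classical
  funext e
  rw [blockRefl_mulVec]
  split_ifs with he
  · simp
  · simp [h _ he]

theorem starSum_sqrt_mul {κ : F → ι} {w : F → ℝ} (hw : ∀ e, 0 < w e) (c : ι → ℂ) (i : ι) :
    starSum κ w (fun e => Real.sqrt (w e) * c (κ e)) i = blockWeight κ w i * c i := by
  classical
  rw [starSum, blockWeight, Complex.ofReal_sum, Finset.sum_mul]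
  refine Finset.sum_congr rfl fun f _ => ?_
  split_ifs with h
  · rw [h, ← mul_assoc, ← Complex.ofReal_mul, Real.mul_self_sqrt (hw f).le]
  · simp

/-- Such a vector is a combination of the star states of the blocks, and `c = 0` on `T` leaves only
blocks that are actually reflected. -/
theorem blockRefl_mulVec_sqrt_mul {κ : F → ι} {w : F → ℝ} (hw : ∀ e, 0 < w e) {T : Set ι}
    {c : ι → ℂ} (hc : ∀ i ∈ T, c i = 0) :
    blockRefl κ w T *ᵥ (fun e => Real.sqrt (w e) * c (κ e))
      = -fun e => Real.sqrt (w e) * c (κ e) := by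
  classical
  funext e
  rw [blockRefl_mulVec, starSum_sqrt_mul hw, Pi.neg_apply]
  have : (blockWeight κ w (κ e) : ℂ) ≠ 0 := 
    Complex.ofReal_ne_zero.2 (blockWeight_pos hw e).ne'
  split_ifs with h
  · simp [hc _ h]
  · field_simp; ring

theorem starSum_blockRefl {κ : F → ι} {w : F → ℝ} (hw : ∀ e, 0 < w e) {T : Set ι} (v : F → ℂ)
    {i : ι} (hi : i ∉ T) :
    starSum κ w (blockRefl κ w T *ᵥ v) i = - starSum κ w v i := by
  classical
  have h1 : starSum κ w (blockRefl κ w T *ᵥ v) i = starSum κ w v i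
      - ∑ f, if κ f = i then (w f : ℂ) * (2 / blockWeight κ w i * starSum κ w v i) else 0 := by
    conv_lhs => rw [starSum]
    conv_rhs => enter [1]; rw [starSum]
    rw [← Finset.sum_sub_distrib]
    refine Finset.sum_congr rfl fun f _ => ?_
    split_ifs with h
    · rw [blockRefl_mulVec, if_neg (h ▸ hi), h, mul_sub]
      congr 1
      have : (w f : ℂ) = Real.sqrt (w f) * Real.sqrt (w f) := by
        rw [← Complex.ofReal_mul, Real.mul_self_sqrt (hw f).le]
      rw [this]; ring
    · simp
  have h2 : (∑ f, if κ f = i then (w f : ℂ) * (2 / blockWeight κ w i * starSum κ w v i) else 0)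
      = blockWeight κ w i * (2 / blockWeight κ w i * starSum κ w v i) := by
    rw [blockWeight, Complex.ofReal_sum, Finset.sum_mul]
    refine Finset.sum_congr rfl fun f _ => ?_
    split_ifs <;> simp
  rw [h1, h2]
  -- For an empty block the weight is `0` and the division is meaningless, but the overlap is `0`
  -- too.
  by_cases hd : ∃ e, κ e = i
  · obtain ⟨e, rfl⟩ := hd
    have : (blockWeight κ w (κ e) : ℂ) ≠ 0 := 
    Complex.ofReal_ne_zero.2 (blockWeight_pos hw e).ne'
    field_simp; ring
  · have : starSum κ w v i = 0 :=
      Finset.sum_eq_zero fun f _ => if_neg fun h => hd ⟨f, h⟩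
    simp [this]

theorem blockRefl_conjTranspose (κ : F → ι) (w : F → ℝ) (T : Set ι) :
    (blockRefl κ w T)ᴴ = blockRefl κ w T := by
  classical
  ext e f
  simp only [Matrix.conjTranspose_apply, blockRefl, Matrix.of_apply]
  by_cases h : κ e = κ f
  · rw [if_pos h, if_pos h.symm, h]
    have h1 : star ((1 : Matrix F F ℂ) f e) = (1 : Matrix F F ℂ) e f := by
      rw [← Matrix.conjTranspose_apply, Matrix.conjTranspose_one]
    split_ifs
    · exact h1
    · rw [star_sub, h1]
      simp [mul_comm]
  · rw [if_neg h, if_neg (Ne.symm h), star_zero]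

open Classical in
theorem blockRefl_mul_self {κ : F → ι} {w : F → ℝ} (hw : ∀ e, 0 < w e) (T : Set ι) :
    blockRefl κ w T * blockRefl κ w T = 1 := by
  refine Matrix.toLin'.injective (LinearMap.ext fun v => ?_)
  rw [Matrix.toLin'_mul, Matrix.toLin'_one, LinearMap.comp_apply, Matrix.toLin'_apply,
    Matrix.toLin'_apply, LinearMap.id_apply]
  funext e
  rw [blockRefl_mulVec, blockRefl_mulVec]
  split_ifs with h
  · simp
  · rw [starSum_blockRefl hw v h]; ring

open Classical in
theorem blockRefl_mem_unitaryGroup {κ : F → ι} {w : F → ℝ} (hw : ∀ e, 0 < w e) (T : Set ι) :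
    blockRefl κ w T ∈ Matrix.unitaryGroup F ℂ := by
  rw [Matrix.mem_unitaryGroup_iff, Matrix.star_eq_conjTranspose, blockRefl_conjTranspose,
    blockRefl_mul_self hw]

end BlockReflection

namespace Network

variable {A : Type u} {B : Type v} {E : Type w} [Fintype E]

theorem starState_mul_star {N : Network A B E} {x : A ⊕ B} {e f : E} (he : N.Inc x e)
    (hf : N.Inc x f) :
    N.starState x e * star (N.starState x f)
      = (Real.sqrt (N.wt e) : ℂ) * Real.sqrt (N.wt f) / N.deg x := by
  classical
  have hd : 0 ≤ N.deg x := Finset.sum_nonneg fun e _ => by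
    split_ifs
    exacts [(N.wt_pos e).le, le_rfl]
  rw [starState, starState, if_pos he, if_pos hf, Complex.star_def, Complex.conj_ofReal,
    ← Complex.ofReal_mul, ← Complex.ofReal_mul, ← Complex.ofReal_div, div_mul_div_comm,
    Real.mul_self_sqrt hd]

theorem reflA_eq (N : Network A B E) (T : Set (A ⊕ B)) :
    N.reflA T = blockRefl N.src N.wt (Sum.inl ⁻¹' T) := by
  classical
  ext e f
  simp only [reflA, blockRefl, Matrix.of_apply]
  split_ifs with h1 h2
  · rw [diffusion, if_pos (show Sum.inl (N.src e) ∈ T from h2)]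
  · rw [diffusion, if_neg (show Sum.inl (N.src e) ∉ T from h2), Matrix.sub_apply,
      Matrix.smul_apply, Matrix.vecMulVec_apply, Pi.star_apply,
      starState_mul_star (show N.Inc (.inl (N.src e)) e from rfl)
      (show N.Inc (.inl (N.src e)) f from h1.symm), nsmul_eq_mul]
    rfl
  · rfl

theorem reflB_eq (N : Network A B E) (T : Set (A ⊕ B)) :
    N.reflB T = blockRefl N.tgt N.wt (Sum.inr ⁻¹' T) := by
  classical
  ext e f
  simp only [reflB, blockRefl, Matrix.of_apply]
  split_ifs with h1 h2
  · rw [diffusion, if_pos (show Sum.inr (N.tgt e) ∈ T from h2)]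
  · rw [diffusion, if_neg (show Sum.inr (N.tgt e) ∉ T from h2), Matrix.sub_apply,
      Matrix.smul_apply, Matrix.vecMulVec_apply, Pi.star_apply,
      starState_mul_star (show N.Inc (.inr (N.tgt e)) e from rfl)
      (show N.Inc (.inr (N.tgt e)) f from h1.symm), nsmul_eq_mul]
    rfl
  · rfl

end Network

/-! ### Averages of the powers of an isometry -/

section Averages

variable {H : Type*} [NormedAddCommGroup H] [InnerProductSpace ℂ H]

/-- The average of the first `T` iterates of `X`. -/
noncomputable def powAvg (X : H →ₗ[ℂ] H) (T : ℕ) (v : H) : H :=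
  (T : ℂ)⁻¹ • ∑ k ∈ Finset.range T, (X ^ k) v

/-- Half the difference of two consecutive averages of `T` iterates of `X`. -/
noncomputable def powDiff (X : H →ₗ[ℂ] H) (T : ℕ) (v : H) : H :=
  (2 : ℂ)⁻¹ • (powAvg X T v - (X ^ T) (powAvg X T v))

theorem powAvg_one (X : H →ₗ[ℂ] H) (v : H) : powAvg X 1 v = v := by simp [powAvg]

theorem powAvg_add (X : H →ₗ[ℂ] H) (T : ℕ) (v v' : H) :
    powAvg X T (v + v') = powAvg X T v + powAvg X T v' := by
  simp [powAvg, Finset.sum_add_distrib, smul_add]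

theorem powAvg_smul (X : H →ₗ[ℂ] H) (T : ℕ) (c : ℂ) (v : H) :
    powAvg X T (c • v) = c • powAvg X T v := by
  simp only [powAvg, map_smul, ← Finset.smul_sum]
  rw [smul_comm]

theorem powAvg_of_fixed {X : H →ₗ[ℂ] H} {T : ℕ} (hT : T ≠ 0) {g : H} (hg : X g = g) :
    powAvg X T g = g := by
  have : ∀ k, (X ^ k) g = g := fun k => by
    induction k with
    | zero => rfl
    | succ k ih => rw [pow_succ, Module.End.mul_apply, hg, ih]
  have hT' : (T : ℂ) ≠ 0 := by exact_mod_cast hT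
  simp only [powAvg, this, Finset.sum_const, Finset.card_range]
  rw [← Nat.cast_smul_eq_nsmul ℂ, smul_smul, inv_mul_cancel₀ hT', one_smul]

theorem powAvg_two_mul (X : H →ₗ[ℂ] H) (T : ℕ) (v : H) :
    powAvg X (2 * T) v = (2 : ℂ)⁻¹ • (powAvg X T v + (X ^ T) (powAvg X T v)) := by
  have : ∑ k ∈ Finset.range (2 * T), (X ^ k) v
      = ∑ k ∈ Finset.range T, (X ^ k) v + (X ^ T) (∑ k ∈ Finset.range T, (X ^ k) v) := by
    rw [two_mul, Finset.sum_range_add, map_sum]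
    congr 1
    exact Finset.sum_congr rfl fun k _ => by rw [pow_add, Module.End.mul_apply]
  rw [powAvg, this, powAvg, map_smul, ← smul_add, smul_smul]
  congr 1
  push_cast
  rw [mul_inv]

variable {X : H →ₗ[ℂ] H} (hX : ∀ v, ‖X v‖ = ‖v‖)
include hX

theorem norm_pow_apply (k : ℕ) (v : H) : ‖(X ^ k) v‖ = ‖v‖ := by
  induction k with
  | zero => rfl
  | succ k ih => rw [pow_succ', Module.End.mul_apply, hX, ih]

theorem norm_powAvg_le (T : ℕ) (v : H) : ‖powAvg X T v‖ ≤ ‖v‖ := by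
  rcases T.eq_zero_or_pos with rfl | hT
  · simp [powAvg]
  have hT' : (0 : ℝ) < T := by exact_mod_cast hT
  rw [powAvg, norm_smul, norm_inv, Complex.norm_natCast, inv_mul_le_iff₀ hT']
  refine (norm_sum_le _ _).trans ?_
  simp [norm_pow_apply hX]

/-- The average over `2T` powers is the midpoint of two vectors of equal norm, and `powDiff` is half
their difference; the parallelogram law relates the two. This turns a decrease of a probability into
a probability that can be sampled directly. -/
theorem norm_powAvg_sq_sub (T : ℕ) (v : H) :
    ‖powAvg X T v‖ ^ 2 - ‖powAvg X (2 * T) v‖ ^ 2 = ‖powDiff X T v‖ ^ 2 := by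
  rw [powAvg_two_mul, powDiff]
  set a := powAvg X T v
  have h1 : ‖(X ^ T) a‖ = ‖a‖ := norm_pow_apply hX T a
  have h2 := parallelogram_law_with_norm ℂ a ((X ^ T) a)
  rw [h1] at h2
  rw [norm_smul, norm_smul, mul_pow, mul_pow]
  norm_num
  linarith

/-- The powers applied to `y - X y` telescope, leaving two boundary terms. -/
theorem norm_powAvg_coboundary_le {T : ℕ} (hT : 0 < T) (y : H) :
    ‖powAvg X T (y - X y)‖ ≤ 2 * ‖y‖ / T := by
  have hT' : (0 : ℝ) < T := by exact_mod_cast hT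
  have h1 : ∑ k ∈ Finset.range T, (X ^ k) (y - X y) = y - (X ^ T) y := by
    have : ∀ k, (X ^ k) (y - X y) = (X ^ k) y - (X ^ (k + 1)) y := fun k => by
      rw [map_sub, pow_succ, Module.End.mul_apply]
    simp only [this]
    rw [Finset.sum_range_sub']
    rfl
  rw [powAvg, h1, norm_smul, norm_inv, Complex.norm_natCast, inv_mul_eq_div]
  gcongr
  have := norm_sub_le y ((X ^ T) y)
  rw [norm_pow_apply hX] at this
  linarith

theorem norm_powAvg_sub_le (T : ℕ) (hT : 0 < T) (b : H) :
    ‖powAvg X T b - b‖ ≤ T * ‖X b - b‖ := by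
  have hT' : (0 : ℝ) < T := by exact_mod_cast hT
  have hTc : (T : ℂ) ≠ 0 := by exact_mod_cast hT.ne'
  have hk : ∀ k : ℕ, ‖(X ^ k) b - b‖ ≤ k * ‖X b - b‖ := fun k => by
    induction k with
    | zero => simp
    | succ k ih =>
      have : (X ^ (k + 1)) b - b = (X ^ k) (X b - b) + ((X ^ k) b - b) := by
        rw [map_sub, pow_succ, Module.End.mul_apply]; abel
      rw [this]
      refine (norm_add_le _ _).trans ?_
      rw [norm_pow_apply hX]
      push_cast
      linarith
  have h1 : powAvg X T b - b = (T : ℂ)⁻¹ • ∑ k ∈ Finset.range T, ((X ^ k) b - b) := by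
    rw [Finset.sum_sub_distrib, smul_sub, powAvg, Finset.sum_const, Finset.card_range,
      ← Nat.cast_smul_eq_nsmul ℂ, smul_smul, inv_mul_cancel₀ hTc, one_smul]
  rw [h1, norm_smul, norm_inv, Complex.norm_natCast, inv_mul_le_iff₀ hT']
  refine (norm_sum_le _ _).trans ?_
  refine (Finset.sum_le_card_nsmul _ _ (T * ‖X b - b‖) fun k hk' => (hk k).trans ?_).trans ?_
  · have : (k : ℝ) ≤ T := by exact_mod_cast (Finset.mem_range.1 hk').le
    gcongr
  · simp

/-- An isometry that fixes `g` preserves its orthogonal complement, so Pythagoras applies to the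
averages. -/
theorem norm_sq_powAvg_add_fixed {T : ℕ} (hT : T ≠ 0) {g r : H} (hg : X g = g)
    (hgr : inner ℂ g r = 0) :
    ‖powAvg X T (g + r)‖ ^ 2 = ‖g‖ ^ 2 + ‖powAvg X T r‖ ^ 2 := by
  have hinner : ∀ k, inner ℂ g ((X ^ k) r) = 0 := fun k => by
    let Y : H →ₗᵢ[ℂ] H := ⟨X, hX⟩
    induction k with
    | zero => exact hgr
    | succ k ih =>
      have h2 := Y.inner_map_map g ((X ^ k) r)
      rw [pow_succ', Module.End.mul_apply]
      rw [ih] at h2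
      rw [← h2]
      congr 1
      exact hg.symm
  have h0 : inner ℂ g (powAvg X T r) = 0 := by
    rw [powAvg, inner_smul_right, inner_sum, Finset.sum_eq_zero fun k _ => hinner k, mul_zero]
  rw [powAvg_add, powAvg_of_fixed hT hg, pow_two, pow_two, pow_two]
  exact norm_add_sq_eq_norm_sq_add_norm_sq_of_inner_eq_zero _ _ h0

end Averages

/-! ### Potential and flow vectors of an abstract walk operator -/

/-- The vectors that govern a walk operator `UA * UB` with the initial state `ψ` of coupling `h`:
`α - β = f + h⁻¹ ψ`, where `α` and `β` are spanned by the star states of the two classes and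
`R f - h ψ` is orthogonal to them. -/
structure WalkData {H : Type*} [NormedAddCommGroup H] [InnerProductSpace ℂ H]
    (UA UB S : H →ₗ[ℂ] H) (ψ : H) (h R W : ℝ) where
  h_pos : 0 < h
  R_pos : 0 < R
  W_nonneg : 0 ≤ W
  norm_UA : ∀ v, ‖UA v‖ = ‖v‖
  norm_UB : ∀ v, ‖UB v‖ = ‖v‖
  norm_S : ∀ v, ‖S v‖ = ‖v‖
  S_self : S ψ = -ψ
  S_orth : ∀ v, inner ℂ ψ v = 0 → S v = v
  norm_ψ : ‖ψ‖ = 1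
  UB_ψ : UB ψ = ψ
  α : H
  β : H
  f : H
  UA_α : UA α = -α
  UB_β : UB β = -β
  UB_f : UB f = f
  UA_f : UA ((R : ℂ) • f - (h : ℂ) • ψ) = (R : ℂ) • f - (h : ℂ) • ψ
  sub_eq : α - β = f + (h : ℂ)⁻¹ • ψ
  ψ_f : inner ℂ ψ f = 0
  ψ_β : inner ℂ ψ β = 0
  norm_f : ‖f‖ ^ 2 = 1 / R
  norm_α : ‖α‖ ^ 2 ≤ W + 1 / h ^ 2
  norm_β : ‖β‖ ^ 2 ≤ W

namespace WalkData

variable {H : Type*} [NormedAddCommGroup H] [InnerProductSpace ℂ H]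
  {UA UB S : H →ₗ[ℂ] H} {ψ : H} {h R W : ℝ}

theorem norm_flow_sq (D : WalkData UA UB S ψ h R W) :
    ‖(R : ℂ) • D.f - (h : ℂ) • ψ‖ ^ 2 = R + h ^ 2 := by
  have h0 : inner ℂ ((R : ℂ) • D.f) (-((h : ℂ) • ψ)) = 0 := by
    rw [inner_neg_right, inner_smul_left, inner_smul_right, inner_eq_zero_symm.1 D.ψ_f]; simp
  have := norm_add_sq_eq_norm_sq_add_norm_sq_of_inner_eq_zero _ _ h0
  rw [sub_eq_add_neg, pow_two, this, norm_neg, norm_smul, norm_smul, D.norm_ψ, Complex.norm_real, Complex.norm_real,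
    Real.norm_of_nonneg D.R_pos.le, Real.norm_of_nonneg D.h_pos.le]
  have hR := D.R_pos.ne'
  have := D.norm_f
  have e : R * ‖D.f‖ * (R * ‖D.f‖) = R ^ 2 * ‖D.f‖ ^ 2 := by ring
  rw [e, this]; field_simp

/-- `φ = R f - h ψ` is fixed by the walk, and `ψ` is a combination of `φ` and `α - β`. The latter is
a coboundary: `U_B` fixes `α - β` and negates `β`, hence `U_B α = α - 2β` and `U_A U_B (α - 2β) =
U_A α = -α`, so half of `α - 2β` has coboundary `α - β`. As `α - 2β = U_B α`, its norm is that of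
`α`. -/
theorem exists_decomp (D : WalkData UA UB S ψ h R W) :
    ∃ g y : H, ψ = g + (y - (UA * UB) y) ∧ (UA * UB) g = g ∧
      inner ℂ g (y - (UA * UB) y) = 0 ∧ ‖g‖ ^ 2 = h ^ 2 / (h ^ 2 + R) ∧
      4 * ‖y‖ ^ 2 ≤ h ^ 2 * W + 1 := by
  have hh := D.h_pos
  have hR := D.R_pos
  have hhc : (h : ℂ) ≠ 0 := by exact_mod_cast hh.ne'
  have hRc : (R : ℂ) ≠ 0 := by exact_mod_cast hR.ne'
  have hs : (h : ℂ) ^ 2 + R ≠ 0 := by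
    have : h ^ 2 + R ≠ 0 := by positivity
    exact_mod_cast this
  set φ := (R : ℂ) • D.f - (h : ℂ) • ψ with hφ
  -- With this coefficient `-c φ` is the orthogonal projection of `ψ` onto `φ`, since `⟨φ, ψ⟩ = -h`
  -- and `‖φ‖² = R + h²`.
  set c : ℂ := h / (h ^ 2 + R) with hc
  have hUBφ : UB φ = φ := by rw [hφ, map_sub, map_smul, map_smul, D.UB_f, D.UB_ψ]
  have hα : D.α - D.β = D.f + (h : ℂ)⁻¹ • ψ := D.sub_eq
  have hψ : ψ = -(c • φ) + (c * R) • (D.α - D.β) := by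
    have e1 : c * R * (h : ℂ)⁻¹ + c * h = 1 := by rw [hc]; field_simp; ring
    rw [hα, hφ]
    calc ψ = (c * R * (h : ℂ)⁻¹ + c * h) • ψ := by rw [e1, one_smul]
      _ = _ := by module
  have hUBα : UB D.α = D.α - (2 : ℂ) • D.β := by
    have e : UB (D.α - D.β) = D.α - D.β := by
      rw [hα, map_add, map_smul, D.UB_f, D.UB_ψ]
    rw [map_sub, D.UB_β, sub_neg_eq_add] at e
    rw [eq_sub_of_add_eq e]; module
  set y := (c * R / 2) • (D.α - (2 : ℂ) • D.β) with hy
  have hr : y - (UA * UB) y = (c * R) • (D.α - D.β) := by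
    have e : (UA * UB) (D.α - (2 : ℂ) • D.β) = - D.α := by
      rw [Module.End.mul_apply, map_sub, map_smul, D.UB_β, hUBα, ← D.UA_α]
      congr 1; module
    rw [hy, map_smul, e]; module
  have hn : ‖-(c • φ)‖ ^ 2 = h ^ 2 / (h ^ 2 + R) := by
    have e : ‖c‖ = h / (h ^ 2 + R) := by
      rw [hc, norm_div, Complex.norm_real, Real.norm_of_nonneg hh.le]
      congr 1
      rw [← Complex.ofReal_pow, ← Complex.ofReal_add, Complex.norm_real]
      exact Real.norm_of_nonneg (by positivity)
    rw [norm_neg, norm_smul, mul_pow, D.norm_flow_sq, e]; field_simp; ring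
  refine ⟨-(c • φ), y, ?_, ?_, ?_, hn, ?_⟩
  · rw [hr]; exact hψ
  · rw [map_neg, map_smul, Module.End.mul_apply, hUBφ, D.UA_f]
  · have e1 : y - (UA * UB) y = ψ - -(c • φ) := by rw [hr]; exact eq_sub_of_add_eq' hψ.symm
    rw [e1, inner_sub_right, inner_self_eq_norm_sq_to_K]
    have e2 : inner ℂ φ ψ = -(h : ℂ) := by
      rw [hφ, inner_sub_left, inner_smul_left, inner_smul_left, inner_eq_zero_symm.1 D.ψ_f,
        inner_self_eq_norm_sq_to_K, D.norm_ψ]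
      simp
    have e3 : ((‖-(c • φ)‖ : ℝ) : ℂ) ^ 2 = h ^ 2 / (h ^ 2 + R) := by
      rw [← Complex.ofReal_pow, hn]; push_cast; rfl
    have e4 : (starRingEnd ℂ) c = c := by
      rw [hc]; simp
    rw [inner_neg_left, inner_smul_left, e2, e4]
    refine sub_eq_zero.2 (Eq.trans ?_ e3.symm)
    rw [hc]; field_simp
  · have e : ‖c * R / 2‖ = h * R / (2 * (h ^ 2 + R)) := by
      have : c * R / 2 = ((h * R / (2 * (h ^ 2 + R)) : ℝ) : ℂ) := by
        rw [hc]; push_cast; field_simp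
      rw [this, Complex.norm_real]
      exact Real.norm_of_nonneg (by positivity)
    rw [hy, norm_smul, e, ← hUBα, D.norm_UB, mul_pow]
    have hα2 := D.norm_α
    have hW := D.W_nonneg
    calc 4 * ((h * R / (2 * (h ^ 2 + R))) ^ 2 * ‖D.α‖ ^ 2)
        ≤ 4 * ((h * R / (2 * (h ^ 2 + R))) ^ 2 * (W + 1 / h ^ 2)) := by gcongr
      _ = (R / (h ^ 2 + R)) ^ 2 * (h ^ 2 * W + 1) := by field_simp; ring
      _ ≤ 1 * (h ^ 2 * W + 1) := by
        gcongr
        refine pow_le_one₀ (by positivity) ((div_le_one (by positivity)).2 ?_)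
        nlinarith
      _ = _ := one_mul _

/-- The sign flip leaves no fixed part: `S φ - φ = 2h ψ`, and the modified walk takes `S φ` to `U_A
U_B φ = φ`. So `ψ` is the coboundary of `S φ / (2h)`. -/
theorem norm_powAvg_le (D : WalkData UA UB S ψ h R W) {T : ℕ} (hT : 0 < T) :
    ‖powAvg (UA * UB * S) T ψ‖ ^ 2 ≤ (h ^ 2 + R) / (h ^ 2 * T ^ 2) := by
  have hh := D.h_pos
  have hhc : (h : ℂ) ≠ 0 := by exact_mod_cast hh.ne'
  have hX : ∀ v, ‖(UA * UB * S) v‖ = ‖v‖ := fun v => by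
    rw [Module.End.mul_apply, Module.End.mul_apply, D.norm_UA, D.norm_UB, D.norm_S]
  have hT' : (0 : ℝ) < T := by exact_mod_cast hT
  set φ := (R : ℂ) • D.f - (h : ℂ) • ψ with hφ
  have hSφ : S φ = φ + (2 * h : ℂ) • ψ := by
    rw [hφ, map_sub, map_smul, map_smul, D.S_self, D.S_orth _ D.ψ_f]; module
  have hSS : S (S φ) = φ := by
    rw [hSφ, map_add, hSφ, map_smul, D.S_self]; module
  set y := (2 * h : ℂ)⁻¹ • S φ with hy
  have hψ : ψ = y - (UA * UB * S) y := by
    have e : (UA * UB * S) (S φ) = φ := by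
      have hUBφ : UB φ = φ := by rw [hφ, map_sub, map_smul, map_smul, D.UB_f, D.UB_ψ]
      rw [Module.End.mul_apply, Module.End.mul_apply, hSS, hUBφ, D.UA_f]
    rw [hy, map_smul, e, hSφ, ← smul_sub, add_sub_cancel_left, smul_smul, inv_mul_cancel₀,
      one_smul]
    simpa using hhc
  have hyn : ‖y‖ = ‖φ‖ / (2 * h) := by
    rw [hy, norm_smul, D.norm_S, norm_inv, norm_mul, Complex.norm_real,
      Real.norm_of_nonneg hh.le]
    simp; ring
  have h1 := norm_powAvg_coboundary_le hX hT y
  rw [← hψ, hyn] at h1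
  have h2 : ‖powAvg (UA * UB * S) T ψ‖ ^ 2 ≤ (2 * (‖φ‖ / (2 * h)) / T) ^ 2 := by gcongr
  refine h2.trans (le_of_eq ?_)
  have := D.norm_flow_sq
  rw [← hφ] at this
  have e : (2 * (‖φ‖ / (2 * h)) / T) ^ 2 = ‖φ‖ ^ 2 / (h ^ 2 * T ^ 2) := by
    field_simp
  rw [e, this, add_comm]

/-- For short times the potential is an almost invariant vector. `b = β + ψ/h = α - f` is moved by
the modified walk only by `f + U_A f`, of norm at most `2/√R`, and `ψ` differs from `h b` by `h β`,
of norm at most `h√W`. -/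
theorem le_norm_powAvg (D : WalkData UA UB S ψ h R W) {T : ℕ} (hT : 0 < T) :
    1 - 2 * (T * (h / Real.sqrt R) + h * Real.sqrt W) ≤ ‖powAvg (UA * UB * S) T ψ‖ := by
  have hh := D.h_pos
  have hhc : (h : ℂ) ≠ 0 := by exact_mod_cast hh.ne'
  have hX : ∀ v, ‖(UA * UB * S) v‖ = ‖v‖ := fun v => by
    rw [Module.End.mul_apply, Module.End.mul_apply, D.norm_UA, D.norm_UB, D.norm_S]
  set X := UA * UB * S with hXdef
  set b := D.β + (h : ℂ)⁻¹ • ψ with hb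
  have hb' : b = D.α - D.f := by
    rw [hb, eq_sub_iff_add_eq, ← sub_eq_iff_eq_add'.1 D.sub_eq |>.symm]
    abel
  have hXb : X b - b = D.f + UA D.f := by
    have e : X b = UA (-b) := by
      rw [hXdef, Module.End.mul_apply, Module.End.mul_apply, hb, map_add, map_smul, D.S_self,
        D.S_orth _ D.ψ_β, map_add, map_smul, map_neg, D.UB_ψ, D.UB_β]
      congr 1; module
    rw [e, hb', map_neg, map_sub, D.UA_α]; abel
  have hf : ‖D.f‖ = 1 / Real.sqrt R := by
    rw [← Real.sqrt_sq (norm_nonneg D.f), D.norm_f, Real.sqrt_div zero_le_one, Real.sqrt_one]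
  have hXbn : ‖X b - b‖ ≤ 2 * (1 / Real.sqrt R) := by
    rw [hXb]
    refine (norm_add_le _ _).trans ?_
    rw [D.norm_UA, hf]; linarith
  have hβ : ‖D.β‖ ≤ Real.sqrt W := Real.le_sqrt_of_sq_le D.norm_β
  have h1 := (norm_powAvg_sub_le hX T hT b).trans
    (mul_le_mul_of_nonneg_left hXbn (Nat.cast_nonneg T))
  have hψ : ψ = (h : ℂ) • b + (-(h : ℂ)) • D.β := by
    rw [hb, smul_add, smul_smul, mul_inv_cancel₀ hhc]; module
  have hdiff : powAvg X T ψ - ψ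
      = (h : ℂ) • (powAvg X T b - b) + (-(h : ℂ)) • (powAvg X T D.β - D.β) := by
    conv_lhs => rw [hψ]
    rw [powAvg_add, powAvg_smul, powAvg_smul]; module
  have h2 : ‖powAvg X T D.β - D.β‖ ≤ 2 * Real.sqrt W := by
    refine (norm_sub_le _ _).trans ?_
    have := _root_.norm_powAvg_le hX T D.β
    linarith
  have h3 : ‖powAvg X T ψ - ψ‖ ≤ h * (T * (2 * (1 / Real.sqrt R))) + h * (2 * Real.sqrt W) := by
    rw [hdiff]
    refine (norm_add_le _ _).trans ?_
    rw [norm_smul, norm_smul, norm_neg, Complex.norm_real, Real.norm_of_nonneg hh.le]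
    gcongr
  have h4 := norm_sub_norm_le ψ (powAvg X T ψ)
  rw [D.norm_ψ, norm_sub_rev] at h4
  have e : h * (T * (2 * (1 / Real.sqrt R))) + h * (2 * Real.sqrt W)
      = 2 * (T * (h / Real.sqrt R) + h * Real.sqrt W) := by ring
  linarith

end WalkData

/-! ### Unitary matrices as isometries -/

section UnitaryAction

variable {F : Type*} [Fintype F]

open Classical in
/-- The action of a matrix on the Hilbert space with basis `F`. -/
noncomputable def matAct (U : Matrix F F ℂ) : EuclideanSpace ℂ F →ₗ[ℂ] EuclideanSpace ℂ F :=
  Matrix.toEuclideanLin U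

theorem matAct_apply (U : Matrix F F ℂ) (v : F → ℂ) :
    matAct U (WithLp.toLp 2 v) = WithLp.toLp 2 (U *ᵥ v) := rfl

theorem ofLp_matAct (U : Matrix F F ℂ) (v : EuclideanSpace ℂ F) :
    (matAct U v).ofLp = U *ᵥ v.ofLp := rfl

theorem matAct_mul (U V : Matrix F F ℂ) : matAct (U * V) = matAct U * matAct V := by
  classical
  exact Matrix.toLpLin_mul_same _ U V

open Classical in
theorem sum_norm_sq_mulVec {U : Matrix F F ℂ} (hU : U ∈ Matrix.unitaryGroup F ℂ) (v : F → ℂ) :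
    ∑ e, ‖(U *ᵥ v) e‖ ^ 2 = ∑ e, ‖v e‖ ^ 2 := by
  have key : ∀ x : F → ℂ, ((∑ e, ‖x e‖ ^ 2 : ℝ) : ℂ) = star x ⬝ᵥ x := fun x => by
    rw [dotProduct, Complex.ofReal_sum]
    refine Finset.sum_congr rfl fun e _ => ?_
    rw [Pi.star_apply, Complex.star_def, Complex.conj_mul', Complex.ofReal_pow]
  apply Complex.ofReal_injective
  rw [key, key, Matrix.star_mulVec, Matrix.dotProduct_mulVec, Matrix.vecMul_vecMul,
    ← Matrix.star_eq_conjTranspose, (Matrix.mem_unitaryGroup_iff').1 hU, Matrix.vecMul_one]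

open Classical in
theorem norm_matAct {U : Matrix F F ℂ} (hU : U ∈ Matrix.unitaryGroup F ℂ)
    (v : EuclideanSpace ℂ F) : ‖matAct U v‖ = ‖v‖ := by
  rw [EuclideanSpace.norm_eq, EuclideanSpace.norm_eq, ofLp_matAct, sum_norm_sq_mulVec hU]

end UnitaryAction

/-! ### The potential and flow vectors of the augmented graph -/

namespace Network

variable {A : Type u} {B : Type v} {E : Type w} [Fintype E]

open Classical in
/-- The sign `-1` at the initial state `|s's⟩` if `b`, and the identity otherwise. -/
noncomputable def initSign (E : Type w) (b : Bool) : Matrix (Option E) (Option E) ℂ :=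
  Matrix.diagonal fun e => if e = none then (if b then -1 else 1) else 1

open Classical in
theorem initSign_mem_unitaryGroup (b : Bool) :
    initSign E b ∈ Matrix.unitaryGroup (Option E) ℂ := by
  rw [Matrix.mem_unitaryGroup_iff, initSign, Matrix.star_eq_conjTranspose,
    Matrix.diagonal_conjTranspose, Matrix.diagonal_mul_diagonal, ← Matrix.diagonal_one]
  congr 1
  funext e
  rw [Pi.star_apply]
  split_ifs <;> simp

theorem inl_mem_augment_iff {M : Set (A ⊕ B)} {a : A} :
    (Sum.inl a : A ⊕ Option B) ∈ Sum.map id some '' M ∪ {Sum.inr none} ↔ Sum.inl a ∈ M := by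
  constructor
  · rintro (⟨x | x, hx, h⟩ | h)
    · simp at h; exact h ▸ hx
    · simp at h
    · simp at h
  · exact fun h => Or.inl ⟨_, h, rfl⟩

theorem inr_some_mem_augment_iff {M : Set (A ⊕ B)} {b : B} :
    (Sum.inr (some b) : A ⊕ Option B) ∈ Sum.map id some '' M ∪ {Sum.inr none}
      ↔ Sum.inr b ∈ M := by
  constructor
  · rintro (⟨x | x, hx, h⟩ | h)
    · simp at h
    · simp at h; exact h ▸ hx
    · simp at h
  · exact fun h => Or.inl ⟨_, h, rfl⟩

open Classical in
-- The coupling is `h = √η` because the new edge has weight `1/η`. Fixed vectors of the reflections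
-- come from flow conservation, negated ones from the vanishing of the potential on `M` and at `s'`.
theorem exists_walkData (N : Network A B E) {s : A} {M : Set (A ⊕ B)} (hs : Sum.inl s ∉ M)
    (hflow : ∃ p, N.IsUnitFlow s M p) (η : Set.Ioi (0 : ℝ)) :
    Nonempty (WalkData
      (matAct ((N.augment s η).reflA (Sum.map id some '' M ∪ {Sum.inr none})))
      (matAct ((N.augment s η).reflB (Sum.map id some '' M ∪ {Sum.inr none})))
      (matAct (initSign E true)) (WithLp.toLp 2 (Pi.single none 1))
      (Real.sqrt η) (N.effRes s M) N.totalWeight) := by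
  obtain ⟨u, hus, huM, hu, hR, hD, hfl⟩ := N.exists_potential hs hflow
  set R := N.effRes s M with hRdef
  set N' := N.augment s η with hN'
  set T : Set (A ⊕ Option B) := Sum.map id some '' M ∪ {Sum.inr none} with hT
  set h := Real.sqrt η with hh
  have hη : (0 : ℝ) < η := η.2
  have hpos : 0 < h := Real.sqrt_pos.2 hη
  have hw0 : Real.sqrt (N'.wt none) = h⁻¹ := by
    change Real.sqrt (1 / η) = _
    rw [one_div, Real.sqrt_inv]
  have hhc : (h : ℂ) ≠ 0 := by exact_mod_cast hpos.ne'
  have hw : ∀ e, 0 < N'.wt e := N'.wt_pos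
  let cA : A → ℂ := fun a => (u (Sum.inl a) : ℝ)
  let cB : Option B → ℂ := fun b => b.elim 0 fun b => ((u (Sum.inr b) : ℝ) : ℂ)
  let f : Option E → ℂ := fun e => e.elim 0 fun e => ((Real.sqrt (N.wt e) * N.grad u e : ℝ) : ℂ)
  let ψ : Option E → ℂ := Pi.single none 1
  have hdiv : ∀ x, x ∉ M → (∑ e, if N.Inc x e then N.wt e * N.grad u e else 0)
      = if x = Sum.inl s then 1 / R else 0 := by
    intro x hx
    have h1 := hfl x hx
    have h2 : (∑ e, if N.Inc x e then R * (N.wt e * N.grad u e) else 0)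
        = R * ∑ e, if N.Inc x e then N.wt e * N.grad u e else 0 := by
      rw [Finset.mul_sum]
      exact Finset.sum_congr rfl fun e _ => by split_ifs <;> simp
    rw [h2] at h1
    split_ifs at h1 ⊢
    · rw [← h1]; field_simp
    · exact (mul_eq_zero.1 h1).resolve_left hR.ne'
  have hstar : ∀ (P : E → Prop), (∑ e, if P e then (Real.sqrt (N.wt e) : ℂ) * f (some e) else 0)
      = ((∑ e, if P e then N.wt e * N.grad u e else 0 : ℝ) : ℂ) := by
    intro P
    rw [Complex.ofReal_sum]
    refine Finset.sum_congr rfl fun e _ => ?_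
    split_ifs
    · have : f (some e) = ((Real.sqrt (N.wt e) * N.grad u e : ℝ) : ℂ) := rfl
      rw [this, ← Complex.ofReal_mul, ← mul_assoc, Real.mul_self_sqrt (N.wt_pos e).le]
    · simp
  have hψsome : ∀ e : E, ψ (some e) = 0 := fun e => by simp [ψ]
  refine ⟨{
    h_pos := hpos
    R_pos := hR
    W_nonneg := Finset.sum_nonneg fun e _ => (N.wt_pos e).le
    norm_UA := fun v => by
      rw [reflA_eq]; exact norm_matAct (blockRefl_mem_unitaryGroup hw _) v
    norm_UB := fun v => by
      rw [reflB_eq]; exact norm_matAct (blockRefl_mem_unitaryGroup hw _) v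
    norm_S := fun v => norm_matAct (by convert initSign_mem_unitaryGroup (E := E) true) v
    S_self := ?_
    S_orth := ?_
    norm_ψ := ?_
    UB_ψ := ?_
    α := WithLp.toLp 2 fun e => Real.sqrt (N'.wt e) * cA (N'.src e)
    β := WithLp.toLp 2 fun e => Real.sqrt (N'.wt e) * cB (N'.tgt e)
    f := WithLp.toLp 2 f
    UA_α := ?_
    UB_β := ?_
    UB_f := ?_
    UA_f := ?_
    sub_eq := ?_
    ψ_f := ?_
    ψ_β := ?_
    norm_f := ?_
    norm_α := ?_
    norm_β := ?_ }⟩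
  · rw [matAct_apply, ← WithLp.toLp_neg]
    congr 1
    funext e
    rw [initSign, Matrix.mulVec_diagonal]
    cases e <;> simp
  · intro v hv
    have hv0 : v.ofLp none = 0 := by simpa [PiLp.inner_apply, Fintype.sum_option] using hv
    refine (WithLp.ofLp_injective 2) ?_
    rw [ofLp_matAct]
    funext e
    rw [initSign, Matrix.mulVec_diagonal]
    cases e <;> simp [hv0]
  · rw [EuclideanSpace.norm_eq]
    simp [Fintype.sum_option]
  · rw [matAct_apply, reflB_eq]
    congr 1
    refine blockRefl_mulVec_of_starSum fun i hi => Finset.sum_eq_zero fun e _ => ?_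
    rcases e with _ | e
    · refine if_neg fun hn => hi ?_
      rw [← hn]
      exact Or.inr rfl
    · simp
  · rw [matAct_apply, ← WithLp.toLp_neg, reflA_eq]
    congr 1
    refine blockRefl_mulVec_sqrt_mul hw fun a ha => ?_
    simp [cA, huM _ (inl_mem_augment_iff.1 ha)]
  · rw [matAct_apply, ← WithLp.toLp_neg, reflB_eq]
    congr 1
    refine blockRefl_mulVec_sqrt_mul hw fun b hb => ?_
    rcases b with _ | b
    · rfl
    · simp [cB, huM _ (inr_some_mem_augment_iff.1 hb)]
  · rw [matAct_apply, reflB_eq]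
    congr 1
    refine blockRefl_mulVec_of_starSum fun i hi => ?_
    rcases i with _ | b
    · exact absurd (Or.inr rfl) hi
    · have hb : Sum.inr b ∉ M := fun hb => hi (inr_some_mem_augment_iff.2 hb)
      have h1 := hstar fun e => N.tgt e = b
      have h2 := hdiv _ hb
      rw [if_neg (by simp)] at h2
      rw [starSum, Fintype.sum_option, if_neg (by simp [hN', augment]), zero_add]
      have h3 : ∀ e, (N'.tgt (some e) = some b) = (N.tgt e = b) := fun e => by
        simp [hN', augment]
      simp only [h3]
      refine h1.trans ?_
      exact Complex.ofReal_eq_zero.2 h2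
  · rw [← WithLp.toLp_smul, ← WithLp.toLp_smul, ← WithLp.toLp_sub, matAct_apply, reflA_eq]
    congr 1
    refine blockRefl_mulVec_of_starSum fun a ha => ?_
    have ha : Sum.inl a ∉ M := fun h => ha (inl_mem_augment_iff.2 h)
    have h1 := hstar fun e => N.src e = a
    have h2 := hdiv _ ha
    rw [starSum, Fintype.sum_option, hw0]
    have h3 : ∀ e, (if N'.src (some e) = a then (Real.sqrt (N'.wt (some e)) : ℂ)
        * ((R : ℂ) • f - (h : ℂ) • ψ) (some e) else 0)
        = R * if N.src e = a then (Real.sqrt (N.wt e) : ℂ) * f (some e) else 0 := fun e => by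
      have : N'.src (some e) = N.src e := rfl
      rw [this]
      split_ifs
      · simp [hψsome, hN', augment]; ring
      · simp
    rw [Finset.sum_congr rfl fun e _ => h3 e, ← Finset.mul_sum, h1]
    have h4 : (∑ e, if N.src e = a then N.wt e * N.grad u e else 0)
      = if a = s then 1 / R else 0 := by
      refine Eq.trans ?_ (h2.trans ?_)
      · rfl
      · simp
    rw [h4]
    have h5 : N'.src none = s := rfl
    have hRc : (R : ℂ) ≠ 0 := by exact_mod_cast hR.ne'
    rw [h5]
    -- At `s` the outflow `R · (1/R)` cancels against the new edge, which contributes `-h · h⁻¹`.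
    by_cases has : s = a
    · rw [if_pos has, if_pos has.symm]
      simp [f]
      field_simp
      simp
    · rw [if_neg has, if_neg (Ne.symm has)]; simp
  · rw [← WithLp.toLp_smul, ← WithLp.toLp_sub, ← WithLp.toLp_add]
    congr 1
    funext e
    rcases e with _ | e
    · have h1 : N'.src none = s := rfl
      have h2 : N'.tgt none = none := rfl
      simp [hw0, h1, h2, cA, cB, hus, f]
    · have h1 : N'.src (some e) = N.src e := rfl
      have h2 : N'.tgt (some e) = some (N.tgt e) := rfl
      have h3 : N'.wt (some e) = N.wt e := rfl
      simp [h1, h2, h3, cA, cB, f, grad]; ring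
  · simp [PiLp.inner_apply, f]
  · have h2 : N'.tgt none = none := rfl
    simp [PiLp.inner_apply, h2, cB]
  · rw [EuclideanSpace.norm_sq_eq, Fintype.sum_option, ← hD]
    simp only [f, Option.elim, Complex.norm_real, Real.norm_eq_abs, sq_abs, norm_zero, mul_pow,
      Real.sq_sqrt (N.wt_pos _).le]
    simp
  -- The extra `1/h²` comes from the new edge, where the potential of the `A`-end `s` is `1`. `β`
  -- has no such term because the potential is `0` at `s'`.
  · rw [EuclideanSpace.norm_sq_eq, Fintype.sum_option, add_comm]
    refine add_le_add (Finset.sum_le_sum fun e _ => ?_) (le_of_eq ?_)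
    · have h1 : N'.src (some e) = N.src e := rfl
      have h3 : N'.wt (some e) = N.wt e := rfl
      obtain ⟨h4, h5⟩ := hu (Sum.inl (N.src e))
      simp only [h1, h3, cA]
      rw [← Complex.ofReal_mul, Complex.norm_real, Real.norm_eq_abs, sq_abs, mul_pow,
        Real.sq_sqrt (N.wt_pos e).le]
      exact mul_le_of_le_one_right (N.wt_pos e).le (pow_le_one₀ h4 h5)
    · have h1 : N'.src none = s := rfl
      simp [hw0, h1, cA, hus]
  · rw [EuclideanSpace.norm_sq_eq, Fintype.sum_option]
    have h2 : N'.tgt none = none := rfl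
    simp only [h2, cB, Option.elim, mul_zero, norm_zero]
    rw [zero_pow two_ne_zero, zero_add]
    refine Finset.sum_le_sum fun e _ => ?_
    have h1 : N'.tgt (some e) = some (N.tgt e) := rfl
    have h3 : N'.wt (some e) = N.wt e := rfl
    obtain ⟨h4, h5⟩ := hu (Sum.inr (N.tgt e))
    simp only [h1, h3]
    rw [← Complex.ofReal_mul, Complex.norm_real, Real.norm_eq_abs, sq_abs, mul_pow,
      Real.sq_sqrt (N.wt_pos e).le]
    exact mul_le_of_le_one_right (N.wt_pos e).le (pow_le_one₀ h4 h5)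

end Network

/-! ### Circuits that measure averages of powers of the walk operator -/

open Classical in
theorem conjTranspose_mem_unitaryGroup {F : Type*} [Fintype F] {U : Matrix F F ℂ}
    (hU : U ∈ Matrix.unitaryGroup F ℂ) : Uᴴ ∈ Matrix.unitaryGroup F ℂ :=
  Unitary.star_mem hU

theorem exists_unitary_col {n : ℕ} (v : Fin (n + 1) → ℂ) (hv : ∑ i, ‖v i‖ ^ 2 = 1) :
    ∃ V : Matrix.unitaryGroup (Fin (n + 1)) ℂ, ∀ i, V.1 i 0 = v i := by
  let x : EuclideanSpace ℂ (Fin (n + 1)) := WithLp.toLp 2 v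
  have hx : ‖x‖ = 1 := by rw [EuclideanSpace.norm_eq]; simp [x, hv]
  have ho : Orthonormal ℂ (({0} : Set (Fin (n + 1))).domRestrict fun _ => x) := by
    constructor
    · exact fun _ => hx
    · intro i j hij
      exact absurd (Subtype.ext (i.2.trans j.2.symm)) hij
  obtain ⟨b, hb⟩ := ho.exists_orthonormalBasis_extension_of_card_eq (by simp)
  refine ⟨⟨Matrix.of fun i j => b j i, ?_⟩, fun i => ?_⟩
  · rw [Matrix.mem_unitaryGroup_iff']
    ext i j
    have := orthonormal_iff_ite.1 b.orthonormal i j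
    rw [Matrix.mul_apply, Matrix.one_apply, ← this, PiLp.inner_apply]
    refine Finset.sum_congr rfl fun l _ => ?_
    simp [mul_comm]
  · simp [hb 0 rfl, x]

open Classical in
/-- A unitary whose first column is the given unit vector. -/
noncomputable def colUnitary {n : ℕ} (v : Fin (n + 1) → ℂ) :
    Matrix.unitaryGroup (Fin (n + 1)) ℂ :=
  if hv : ∑ i, ‖v i‖ ^ 2 = 1 then (exists_unitary_col v hv).choose else 1

theorem colUnitary_apply {n : ℕ} {v : Fin (n + 1) → ℂ} (hv : ∑ i, ‖v i‖ ^ 2 = 1)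
    (i : Fin (n + 1)) : (colUnitary v).1 i 0 = v i := by
  rw [colUnitary, dif_pos hv]
  exact (exists_unitary_col v hv).choose_spec i

namespace Network

variable {A : Type u} {B : Type v} {E : Type w} [Fintype E]

open Classical in
theorem walkStep_mem_unitaryGroup (N : Network A B E) (s : A) (M : Set (A ⊕ B))
    (η : Set.Ioi (0 : ℝ)) : N.walkStep s M η ∈ Matrix.unitaryGroup (Option E) ℂ := by
  rw [walkStep, walkOp, reflA_eq, reflB_eq]
  have h := fun T => blockRefl_mem_unitaryGroup (κ := (N.augment s η).src)
    (N.augment s η).wt_pos T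
  have h' := fun T => blockRefl_mem_unitaryGroup (κ := (N.augment s η).tgt)
    (N.augment s η).wt_pos T
  convert mul_mem (h _) (h' _)

end Network

namespace Gate

variable {A : Type u} {B : Type v} {E : Type w} [Fintype E]
  {N : Network A B E} {s : A} {M : Set (A ⊕ B)} {k : ℕ}

open Classical in
theorem op_work_mulVec (V₀ V₁ : Matrix.unitaryGroup (Fin (k + 1)) ℂ)
    (φ : Option E × Fin (k + 1) → ℂ) (e : Option E) (i : Fin (k + 1)) :
    ((Gate.work V₀ V₁).op N s M *ᵥ φ) (e, i)
      = ((if e = none then V₁.1 else V₀.1) *ᵥ fun j => φ (e, j)) i := by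
  rw [Matrix.mulVec, dotProduct, Fintype.sum_prod_type, Finset.sum_eq_single e]
  · rw [Matrix.mulVec, dotProduct]
    refine Finset.sum_congr rfl fun j _ => ?_
    simp only [op, Matrix.of_apply, if_true]
    split_ifs <;> rfl
  · intro e' _ he'
    refine Finset.sum_eq_zero fun j _ => ?_
    simp [op, Ne.symm he']
  · simp

open Classical in
theorem controlled_mulVec {F : Type w} [Fintype F] (S : Finset (Fin (k + 1))) (U : Matrix F F ℂ)
    (φ : F × Fin (k + 1) → ℂ) (e : F) (i : Fin (k + 1)) :
    (controlled S U *ᵥ φ) (e, i) = if i ∈ S then (U *ᵥ fun e' => φ (e', i)) e else φ (e, i) := by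
  have h1 : (controlled S U *ᵥ φ) (e, i)
      = ((if i ∈ S then U else 1) *ᵥ fun e' => φ (e', i)) e := by
    rw [Matrix.mulVec, dotProduct, Fintype.sum_prod_type_right, Finset.sum_eq_single i]
    · rw [Matrix.mulVec, dotProduct]
      refine Finset.sum_congr rfl fun e' _ => ?_
      simp only [controlled, Matrix.of_apply, if_true]
      split_ifs <;> rfl
    · intro j _ hj
      refine Finset.sum_eq_zero fun e' _ => ?_
      simp [controlled, Ne.symm hj]
    · simp
  rw [h1]
  split_ifs
  · rfl
  · rw [Matrix.one_mulVec]

open Classical in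
theorem sum_norm_sq_controlled {F : Type w} [Fintype F] {S : Finset (Fin (k + 1))}
    {U : Matrix F F ℂ} (hU : U ∈ Matrix.unitaryGroup F ℂ) (φ : F × Fin (k + 1) → ℂ) :
    ∑ p, ‖(controlled S U *ᵥ φ) p‖ ^ 2 = ∑ p, ‖φ p‖ ^ 2 := by
  rw [Fintype.sum_prod_type_right, Fintype.sum_prod_type_right]
  refine Finset.sum_congr rfl fun i _ => ?_
  simp only [controlled_mulVec]
  split_ifs
  · exact sum_norm_sq_mulVec hU _
  · rfl

theorem sum_norm_sq_op (g : Gate k) (φ : Option E × Fin (k + 1) → ℂ) :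
    ∑ p, ‖(g.op N s M *ᵥ φ) p‖ ^ 2 = ∑ p, ‖φ p‖ ^ 2 := by
  classical
  rcases g with ⟨V₀, V₁⟩ | ⟨η, S⟩ | ⟨η, S⟩
  · rw [Fintype.sum_prod_type, Fintype.sum_prod_type]
    refine Finset.sum_congr rfl fun e _ => ?_
    simp only [op_work_mulVec]
    refine sum_norm_sq_mulVec ?_ _
    split_ifs
    · convert V₁.2
    · convert V₀.2
  · exact sum_norm_sq_controlled (by convert N.walkStep_mem_unitaryGroup s M η) φ
  · exact sum_norm_sq_controlled (conjTranspose_mem_unitaryGroup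
      (by convert N.walkStep_mem_unitaryGroup s M η)) φ

end Gate

namespace Circuit

variable {A : Type u} {B : Type v} {E : Type w} [Fintype E]

theorem sum_outcomeProb (C : Circuit) (N : Network A B E) (s : A) (M : Set (A ⊕ B)) :
    ∑ i, C.outcomeProb N s M i = 1 := by
  classical
  have h : ∀ (l : List (Gate C.k)) (φ : Option E × Fin (C.k + 1) → ℂ),
      ∑ p, ‖l.foldl (fun ψ g => (g.op N s M) *ᵥ ψ) φ p‖ ^ 2 = ∑ p, ‖φ p‖ ^ 2 := by
    intro l
    induction l with
    | nil => intro φ; rfl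
    | cons g l ih => intro φ; rw [List.foldl_cons, ih, Gate.sum_norm_sq_op]
  simp only [outcomeProb]
  rw [← Fintype.sum_prod_type_right (f := fun p => ‖C.finalState N s M p‖ ^ 2), finalState, h]
  rw [Finset.sum_eq_single (none, 0)]
  · simp
  · intro p _ hp
    simp [Pi.single_eq_of_ne hp]
  · simp

theorem outcomeProb_nonneg (C : Circuit) (N : Network A B E) (s : A) (M : Set (A ⊕ B))
    (i : Fin (C.k + 1)) : 0 ≤ C.outcomeProb N s M i :=
  Finset.sum_nonneg fun _ _ => sq_nonneg _

/-- The sign `-1` at the initial state, controlled on the work register being in `S`. -/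
noncomputable def signGate {k : ℕ} (b : Bool) (S : Finset (Fin (k + 1))) : Gate k :=
  .work 1 ⟨Matrix.diagonal fun i => if i ∈ S then (if b then -1 else 1) else 1, by
    rw [Matrix.mem_unitaryGroup_iff, Matrix.star_eq_conjTranspose,
      Matrix.diagonal_conjTranspose, Matrix.diagonal_mul_diagonal, ← Matrix.diagonal_one]
    congr 1
    funext i
    rw [Pi.star_apply]
    split_ifs <;> simp⟩

/-- The gates that raise the power of the walk operator (preceded by the sign `-1` at the initial
state if `b`) from `j` to `j + 1` where the work register exceeds `j`. -/
noncomputable def powerGates (b : Bool) (η : Set.Ioi (0 : ℝ)) (k j : ℕ) : List (Gate k) :=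
  [signGate b {i | j < i.val}, .walk η {i | j < i.val}]

/-- The circuit whose outcome `0` has the amplitude `(k + 1)⁻¹ ∑ σ i X ^ i`, where `X` is the walk
operator, preceded by the sign `-1` at the initial state if `b`. -/
noncomputable def powerCircuit (b : Bool) (η : Set.Ioi (0 : ℝ)) (k : ℕ)
    (σ : Fin (k + 1) → ℝ) : Circuit where
  k := k
  gates := .work (colUnitary fun _ => ((Real.sqrt (k + 1))⁻¹ : ℝ))
      (colUnitary fun _ => ((Real.sqrt (k + 1))⁻¹ : ℝ))
    :: ((List.range k).flatMap (powerGates b η k)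
      ++ [.work (star (colUnitary fun i => (σ i * (Real.sqrt (k + 1))⁻¹ : ℝ)))
        (star (colUnitary fun i => (σ i * (Real.sqrt (k + 1))⁻¹ : ℝ)))])

theorem steps_powerCircuit (b : Bool) (η : Set.Ioi (0 : ℝ)) (k : ℕ) (σ : Fin (k + 1) → ℝ) :
    (powerCircuit b η k σ).steps = k := by
  have h : ∀ m, (((List.range m).flatMap (powerGates b η k)).map Gate.steps).sum = m := by
    intro m
    induction m with
    | zero => rfl
    | succ m ih =>
      rw [List.range_succ, List.flatMap_append, List.map_append, List.sum_append, ih]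
      rfl
  rw [steps, powerCircuit]
  simp only [List.map_cons, List.map_append, List.sum_cons, List.sum_append, h]
  simp [Gate.steps]

end Circuit

namespace Network

variable {A : Type u} {B : Type v} {E : Type w} [Fintype E]

/-- The walk operator as a linear map, preceded by the sign `-1` at the initial state if `b`. -/
noncomputable def walkAct (N : Network A B E) (s : A) (M : Set (A ⊕ B)) (b : Bool)
    (η : Set.Ioi (0 : ℝ)) : EuclideanSpace ℂ (Option E) →ₗ[ℂ] EuclideanSpace ℂ (Option E) :=
  matAct (N.walkStep s M η * initSign E b)

open Classical in
/-- The initial state `|s's⟩`. -/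
noncomputable def initState (E : Type w) : EuclideanSpace ℂ (Option E) :=
  WithLp.toLp 2 (Pi.single none 1)

theorem norm_walkAct (N : Network A B E) (s : A) (M : Set (A ⊕ B)) (b : Bool)
    (η : Set.Ioi (0 : ℝ)) (v : EuclideanSpace ℂ (Option E)) :
    ‖N.walkAct s M b η v‖ = ‖v‖ := by
  classical
  refine norm_matAct ?_ v
  have := mul_mem (N.walkStep_mem_unitaryGroup s M η) (initSign_mem_unitaryGroup (E := E) b)
  convert this

end Network

namespace Circuit

variable {A : Type u} {B : Type v} {E : Type w} [Fintype E]

open Classical in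
-- The work register acts as a clock: round `j` advances exactly the branches `i > j`, so after `m`
-- rounds branch `i` carries the power `min m i`.
theorem foldl_powerGates (N : Network A B E) (s : A) (M : Set (A ⊕ B)) (b : Bool)
    (η : Set.Ioi (0 : ℝ)) (k : ℕ) (a : ℂ) (m : ℕ) :
    ((List.range m).flatMap (powerGates b η k)).foldl (fun ψ g => (g.op N s M) *ᵥ ψ)
      (fun p : Option E × Fin (k + 1) => a * (Network.initState E).ofLp p.1)
      = fun p => a * (((N.walkAct s M b η) ^ (min m p.2.val)) (Network.initState E)).ofLp p.1 := by
  induction m with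
  | zero => simp
  | succ m ih =>
    rw [List.range_succ, List.flatMap_append, List.foldl_append, ih]
    simp only [powerGates, List.flatMap_cons, List.flatMap_nil, List.append_nil, List.foldl_cons,
      List.foldl_nil]
    funext p
    obtain ⟨e, i⟩ := p
    rw [show (Gate.walk η {i | m < i.val} : Gate k).op N s M
      = Gate.controlled {i | m < i.val} (N.walkStep s M η) from rfl, Gate.controlled_mulVec]
    set X := N.walkAct s M b η with hX
    have hsign : ∀ e', ((signGate b ({i | m < i.val} : Finset (Fin (k + 1)))).op N s M *ᵥ
        fun p : Option E × Fin (k + 1) => a * ((X ^ (min m p.2.val)) (Network.initState E)).ofLp p.1)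
          (e', i) = if m < i.val then
            a * (Network.initSign E b *ᵥ ((X ^ (min m i.val)) (Network.initState E)).ofLp) e'
            else a * ((X ^ (min m i.val)) (Network.initState E)).ofLp e' := by
      intro e'
      rw [signGate, Gate.op_work_mulVec]
      by_cases he : e' = none
      · rw [if_pos he, Matrix.mulVec_diagonal, Network.initSign, Matrix.mulVec_diagonal, if_pos he]
        simp only [Finset.mem_filter, Finset.mem_univ, true_and]
        split_ifs <;> ring
      · rw [if_neg he, Network.initSign, Matrix.mulVec_diagonal, if_neg he]
        simp
    simp only [hsign, Finset.mem_filter, Finset.mem_univ, true_and]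
    by_cases hm : m < i.val
    · simp only [if_pos hm]
      have h1 : min m i.val = m := min_eq_left hm.le
      have h2 : min (m + 1) i.val = m + 1 := min_eq_left hm
      rw [h1, h2, pow_succ', Module.End.mul_apply]
      conv_rhs => rw [hX, Network.walkAct, ofLp_matAct, ← Matrix.mulVec_mulVec]
      have : (fun e' => a * (Network.initSign E b *ᵥ
          ((X ^ m) (Network.initState E)).ofLp) e')
          = a • (Network.initSign E b *ᵥ ((X ^ m) (Network.initState E)).ofLp) := rfl
      rw [this, Matrix.mulVec_smul]
      rfl
    · simp only [if_neg hm]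
      have h1 : min m i.val = i.val := min_eq_right (not_lt.1 hm)
      have h2 : min (m + 1) i.val = i.val := min_eq_right (by omega)
      rw [h1, h2]

/-- The uniform superposition of the clock is prepared, and outcome `0` projects it onto the
superposition with signs `σ`; each of the two contributes a factor `(k + 1)^(-1/2)`. -/
theorem outcomeProb_powerCircuit (N : Network A B E) (s : A) (M : Set (A ⊕ B)) (b : Bool)
    (η : Set.Ioi (0 : ℝ)) (k : ℕ) {σ : Fin (k + 1) → ℝ} (hσ : ∀ i, |σ i| = 1) :
    (powerCircuit b η k σ).outcomeProb N s M 0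
      = ‖((k + 1 : ℕ) : ℂ)⁻¹ • ∑ i, (σ i : ℂ) •
        ((N.walkAct s M b η) ^ i.val) (Network.initState E)‖ ^ 2 := by
  classical
  set X := N.walkAct s M b η
  have hk : (0 : ℝ) < k + 1 := by positivity
  have hunit : ∀ τ : Fin (k + 1) → ℝ, (∀ i, |τ i| = 1) →
      ∑ i, ‖((τ i * (Real.sqrt (k + 1))⁻¹ : ℝ) : ℂ)‖ ^ 2 = 1 := by
    intro τ hτ
    simp only [Complex.norm_real, Real.norm_eq_abs, abs_mul, hτ, one_mul, sq_abs]
    simp [inv_pow, Real.sq_sqrt hk.le, hk.ne']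
  have hunit1 : ∑ i : Fin (k + 1), ‖(((Real.sqrt (k + 1))⁻¹ : ℝ) : ℂ)‖ ^ 2 = 1 := by
    simpa using hunit (fun _ => 1) (by simp)
  have hstate : ∀ e, (powerCircuit b η k σ).finalState N s M (e, 0)
      = (((k + 1 : ℕ) : ℂ)⁻¹ • ∑ i, (σ i : ℂ) • (X ^ i.val) (Network.initState E)).ofLp e := by
    intro e
    have hinit : (Gate.work (colUnitary fun _ : Fin (k + 1) => (((Real.sqrt (k + 1))⁻¹ : ℝ) : ℂ))
        (colUnitary fun _ => (((Real.sqrt (k + 1))⁻¹ : ℝ) : ℂ))).op N s M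
          *ᵥ Pi.single ((none, 0) : Option E × Fin (k + 1)) 1
        = fun p => (((Real.sqrt (k + 1))⁻¹ : ℝ) : ℂ) * (Network.initState E).ofLp p.1 := by
      funext p
      obtain ⟨e', i⟩ := p
      rw [Gate.op_work_mulVec]
      by_cases he : e' = none
      · subst he
        have : (fun j => (Pi.single ((none, 0) : Option E × Fin (k + 1)) (1 : ℂ)
            : Option E × Fin (k + 1) → ℂ) (none, j)) = Pi.single 0 1 := by
          funext j
          simp [Pi.single_apply]
        rw [if_pos rfl, this, Matrix.mulVec_single_one, Matrix.col_apply, colUnitary_apply hunit1]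
        simp [Network.initState]
      · have : (fun j => (Pi.single ((none, 0) : Option E × Fin (k + 1)) (1 : ℂ)
            : Option E × Fin (k + 1) → ℂ) (e', j)) = 0 := by
          funext j
          simp [he]
        rw [this, Matrix.mulVec_zero]
        simp [Network.initState, he]
    rw [finalState, powerCircuit]
    simp only [List.foldl_cons, List.foldl_append, List.foldl_nil]
    rw [show (Pi.single (none, 0) 1 : Option E × Fin (k + 1) → ℂ)
      = Pi.single ((none, 0) : Option E × Fin (k + 1)) 1 from rfl, hinit, foldl_powerGates,
      Gate.op_work_mulVec, ite_self, Matrix.mulVec, dotProduct, WithLp.ofLp_smul, Pi.smul_apply,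
      WithLp.ofLp_sum, Finset.sum_apply, Finset.smul_sum]
    refine Finset.sum_congr rfl fun i _ => ?_
    have h1 : (star (colUnitary fun i => ((σ i * (Real.sqrt (k + 1))⁻¹ : ℝ) : ℂ))).1 0 i
        = ((σ i * (Real.sqrt (k + 1))⁻¹ : ℝ) : ℂ) := by
      change star ((colUnitary fun i => ((σ i * (Real.sqrt (k + 1))⁻¹ : ℝ) : ℂ)).1 i 0) = _
      rw [colUnitary_apply (hunit σ hσ), Complex.star_def, Complex.conj_ofReal]
    have h2 : min k i.val = i.val := min_eq_right (Nat.lt_succ_iff.1 i.2)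
    rw [h1]
    simp only [h2, WithLp.ofLp_smul, Pi.smul_apply, smul_eq_mul]
    have h3 : (((Real.sqrt (k + 1))⁻¹ : ℝ) : ℂ) * (((Real.sqrt (k + 1))⁻¹ : ℝ) : ℂ)
        = ((k + 1 : ℕ) : ℂ)⁻¹ := by
      rw [← Complex.ofReal_mul, ← mul_inv, Real.mul_self_sqrt hk.le]; push_cast; rfl
    rw [← h3]; push_cast; ring
  rw [outcomeProb, EuclideanSpace.norm_sq_eq]
  exact Finset.sum_congr rfl fun e _ => by rw [← hstate]

/-- The circuit whose outcome `0` has the amplitude of the average of the first `T` powers. -/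
noncomputable def avgCircuit (b : Bool) (η : Set.Ioi (0 : ℝ)) (T : ℕ) : Circuit :=
  powerCircuit b η (T - 1) fun _ => 1

/-- The circuit whose outcome `0` has the amplitude of half the difference of the averages of the
first and of the next `T` powers. -/
noncomputable def diffCircuit (b : Bool) (η : Set.Ioi (0 : ℝ)) (T : ℕ) : Circuit :=
  powerCircuit b η (2 * T - 1) fun i => if i.val < T then 1 else -1

theorem steps_avgCircuit_le (b : Bool) (η : Set.Ioi (0 : ℝ)) (T : ℕ) :
    (avgCircuit b η T).steps ≤ T := by
  rw [avgCircuit, steps_powerCircuit]; exact Nat.sub_le _ _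

theorem steps_diffCircuit_le (b : Bool) (η : Set.Ioi (0 : ℝ)) (T : ℕ) :
    (diffCircuit b η T).steps ≤ 2 * T := by
  rw [diffCircuit, steps_powerCircuit]; exact Nat.sub_le _ _

theorem outcomeProb_avgCircuit (N : Network A B E) (s : A) (M : Set (A ⊕ B)) (b : Bool)
    (η : Set.Ioi (0 : ℝ)) {T : ℕ} (hT : 0 < T) :
    (avgCircuit b η T).outcomeProb N s M 0
      = ‖powAvg (N.walkAct s M b η) T (Network.initState E)‖ ^ 2 := by
  rw [avgCircuit]
  refine (outcomeProb_powerCircuit N s M b η (T - 1) (by simp)).trans ?_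
  -- A clock with `T` states needs only `T - 1` walk steps, as the highest power is `T - 1`;
  -- truncated subtraction is harmless for `T > 0`.
  have h : T - 1 + 1 = T := Nat.sub_add_cancel hT
  rw [powAvg]
  simp only [Complex.ofReal_one, one_smul]
  rw [Fin.sum_univ_eq_sum_range (fun i => (N.walkAct s M b η ^ i) (Network.initState E)), h]

theorem outcomeProb_diffCircuit (N : Network A B E) (s : A) (M : Set (A ⊕ B)) (b : Bool)
    (η : Set.Ioi (0 : ℝ)) {T : ℕ} (hT : 0 < T) :
    (diffCircuit b η T).outcomeProb N s M 0
      = ‖powDiff (N.walkAct s M b η) T (Network.initState E)‖ ^ 2 := by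
  rw [diffCircuit]
  refine (outcomeProb_powerCircuit N s M b η (2 * T - 1)
    (fun i => by split_ifs <;> simp)).trans ?_
  have h : 2 * T - 1 + 1 = 2 * T := Nat.sub_add_cancel (by omega)
  set X := N.walkAct s M b η
  set ψ := Network.initState E
  congr 2
  rw [Fin.sum_univ_eq_sum_range
    (fun i => (((if i < T then 1 else -1 : ℝ) : ℝ) : ℂ) • (X ^ i) ψ), h, two_mul,
    Finset.sum_range_add]
  have h1 : ∑ i ∈ Finset.range T, (((if i < T then 1 else -1 : ℝ) : ℝ) : ℂ) • (X ^ i) ψ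
      = ∑ i ∈ Finset.range T, (X ^ i) ψ :=
    Finset.sum_congr rfl fun i hi => by simp [Finset.mem_range.1 hi]
  have h2 : ∑ i ∈ Finset.range T, (((if T + i < T then 1 else -1 : ℝ) : ℝ) : ℂ) • (X ^ (T + i)) ψ
      = - (X ^ T) (∑ i ∈ Finset.range T, (X ^ i) ψ) := by
    rw [map_sum, ← Finset.sum_neg_distrib]
    refine Finset.sum_congr rfl fun i hi => ?_
    simp [pow_add]
  rw [h1, h2, powDiff, powAvg, map_smul, ← smul_sub, smul_smul, ← sub_eq_add_neg]
  congr 1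
  push_cast
  rw [← two_mul, mul_inv]

end Circuit

/-! ### Running a list of circuits -/

section Expectation

variable {A : Type u} {B : Type v} {E : Type w} [Fintype E]

/-- The expectation of a function of the outcomes of a list of circuits. -/
noncomputable def expect (N : Network A B E) (s : A) (M : Set (A ⊕ B)) :
    List Circuit → (List ℕ → ℝ) → ℝ
  | [], f => f []
  | C :: cs, f => ∑ i : Fin (C.k + 1),
      C.outcomeProb N s M i * expect N s M cs (fun os => f (i.val :: os))

variable {N : Network A B E} {s : A} {M : Set (A ⊕ B)}

theorem expect_mono (cs : List Circuit) {f g : List ℕ → ℝ} (h : ∀ os, f os ≤ g os) :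
    expect N s M cs f ≤ expect N s M cs g := by
  induction cs generalizing f g with
  | nil => exact h []
  | cons C cs ih =>
    exact Finset.sum_le_sum fun i _ =>
      mul_le_mul_of_nonneg_left (ih fun os => h _) (C.outcomeProb_nonneg N s M i)

theorem expect_const_mul_add (cs : List Circuit) (a c : ℝ) (f : List ℕ → ℝ) :
    expect N s M cs (fun os => a * f os + c) = a * expect N s M cs f + c := by
  induction cs generalizing f with
  | nil => rfl
  | cons C cs ih =>
    simp only [expect, ih, mul_add, Finset.sum_add_distrib, ← Finset.sum_mul,
      C.sum_outcomeProb N s M, one_mul, Finset.mul_sum]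
    congr 1
    exact Finset.sum_congr rfl fun i _ => by ring

theorem expect_const (cs : List Circuit) (c : ℝ) : expect N s M cs (fun _ => c) = c := by
  simpa using expect_const_mul_add cs 0 c fun _ => 0

/-- The sum of the coefficients at the positions of the outcomes `0`. -/
noncomputable def zeroSum : List ℝ → List ℕ → ℝ
  | a :: as, o :: os => (if o = 0 then a else 0) + zeroSum as os
  | _, _ => 0

variable (N s M) in
/-- The probability of the outcome `0`. -/
noncomputable def zeroProb (C : Circuit) : ℝ := C.outcomeProb N s M 0

theorem zeroProb_nonneg (C : Circuit) : 0 ≤ zeroProb N s M C := C.outcomeProb_nonneg N s M 0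

theorem zeroProb_le_one (C : Circuit) : zeroProb N s M C ≤ 1 := by
  rw [← C.sum_outcomeProb N s M]
  exact Finset.single_le_sum (fun i _ => C.outcomeProb_nonneg N s M i) (Finset.mem_univ _)

theorem sum_outcomeProb_ite (C : Circuit) (a b : ℝ) :
    ∑ i : Fin (C.k + 1), C.outcomeProb N s M i * (if i.val = 0 then a else b)
      = zeroProb N s M C * a + (1 - zeroProb N s M C) * b := by
  have h1 : ∀ i : Fin (C.k + 1), C.outcomeProb N s M i * (if i.val = 0 then a else b)
      = C.outcomeProb N s M i * b
        + if i = 0 then C.outcomeProb N s M i * (a - b) else 0 := by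
    intro i
    by_cases hi : i = 0
    · subst hi; simp; ring
    · have : i.val ≠ 0 := fun h => hi (Fin.ext h)
      simp [hi, this]
  rw [Finset.sum_congr rfl fun i _ => h1 i, Finset.sum_add_distrib, ← Finset.sum_mul,
    C.sum_outcomeProb N s M]
  simp [zeroProb]; ring

variable (N s M) in
/-- The mean of `zeroSum`. -/
noncomputable def zeroMean (ws : List (Circuit × ℝ)) : ℝ :=
  (ws.map fun x => x.2 * zeroProb N s M x.1).sum

variable (N s M) in
/-- An upper bound on the variance of `zeroSum`. -/
noncomputable def zeroVar (ws : List (Circuit × ℝ)) : ℝ :=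
  (ws.map fun x => x.2 ^ 2 * zeroProb N s M x.1).sum

theorem expect_zeroSum (ws : List (Circuit × ℝ)) :
    expect N s M (ws.map Prod.fst) (fun os => zeroSum (ws.map Prod.snd) os)
      = zeroMean N s M ws := by
  induction ws with
  | nil => rfl
  | cons x ws ih =>
    simp only [List.map_cons, expect, zeroSum, zeroMean, List.sum_cons]
    have h1 : ∀ a : ℝ, expect N s M (ws.map Prod.fst)
        (fun os => a + zeroSum (ws.map Prod.snd) os) = a + zeroMean N s M ws := fun a => by
      rw [← ih, add_comm a]
      simpa [add_comm] using expect_const_mul_add (N := N) (s := s) (M := M)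
        (ws.map Prod.fst) 1 a (fun os => zeroSum (ws.map Prod.snd) os)
    simp only [h1]
    have h2 : ∀ i : Fin (x.1.k + 1), x.1.outcomeProb N s M i
        * ((if i.val = 0 then x.2 else 0) + zeroMean N s M ws)
        = x.1.outcomeProb N s M i
          * (if i.val = 0 then x.2 + zeroMean N s M ws else zeroMean N s M ws) := by
      intro i; split_ifs <;> simp
    rw [Finset.sum_congr rfl fun i _ => h2 i, sum_outcomeProb_ite, zeroMean]
    ring

/-- The shift `c` lets the induction absorb the outcomes already seen. Independence makes variances
add, and a single term `a² p (1 - p)` is bounded by `a² p`. -/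
theorem expect_zeroSum_sq_le (ws : List (Circuit × ℝ)) (c : ℝ) :
    expect N s M (ws.map Prod.fst) (fun os => (c + zeroSum (ws.map Prod.snd) os) ^ 2)
      ≤ (c + zeroMean N s M ws) ^ 2 + zeroVar N s M ws := by
  induction ws generalizing c with
  | nil => simp [expect, zeroSum, zeroMean, zeroVar]
  | cons x ws ih =>
    simp only [List.map_cons, expect, zeroSum, zeroMean, zeroVar, List.sum_cons]
    simp only [← add_assoc]
    set m := zeroMean N s M ws with hm
    set V := zeroVar N s M ws with hV
    have h2 : ∀ i : Fin (x.1.k + 1), x.1.outcomeProb N s M i * expect N s M (ws.map Prod.fst)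
          (fun os => (c + (if i.val = 0 then x.2 else 0) + zeroSum (ws.map Prod.snd) os) ^ 2)
        ≤ x.1.outcomeProb N s M i
          * (if i.val = 0 then (c + x.2 + m) ^ 2 + V else (c + m) ^ 2 + V) := by
      intro i
      refine mul_le_mul_of_nonneg_left ((ih _).trans (le_of_eq ?_))
        (x.1.outcomeProb_nonneg N s M i)
      split_ifs <;> simp
    refine (Finset.sum_le_sum fun i _ => h2 i).trans ?_
    rw [sum_outcomeProb_ite]
    have hm' : (ws.map fun x => x.2 * zeroProb N s M x.1).sum = m := rfl
    have hV' : (ws.map fun x => x.2 ^ 2 * zeroProb N s M x.1).sum = V := rfl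
    rw [hm', hV']
    have h3 := zeroProb_nonneg (N := N) (s := s) (M := M) x.1
    set p := zeroProb N s M x.1
    -- The slack in the inequality is exactly `(x.2 * p)²`, the square of the mean of this term.
    have h4 : 0 ≤ (x.2 * p) ^ 2 := sq_nonneg _
    nlinarith

/-- Chebyshev's inequality for `zeroSum`. -/
theorem expect_ge_of_zeroSum (ws : List (Circuit × ℝ)) {f : List ℕ → ℝ} {v δ : ℝ} (hδ : 0 < δ)
    (hv0 : 0 ≤ v) (hf0 : ∀ os, 0 ≤ f os)
    (hf : ∀ os, |zeroSum (ws.map Prod.snd) os - zeroMean N s M ws| < δ → v ≤ f os) :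
    v * (1 - zeroVar N s M ws / δ ^ 2) ≤ expect N s M (ws.map Prod.fst) f := by
  -- A pointwise parabola below `f`: at most `v` near the mean and nonpositive at distance `δ` or
  -- more. Its expectation needs only the second moment.
  have h1 : ∀ os, -(v / δ ^ 2) * (-zeroMean N s M ws + zeroSum (ws.map Prod.snd) os) ^ 2 + v
      ≤ f os := by
    intro os
    by_cases h : |zeroSum (ws.map Prod.snd) os - zeroMean N s M ws| < δ
    · refine le_trans ?_ (hf os h)
      have : 0 ≤ v / δ ^ 2 * (-zeroMean N s M ws + zeroSum (ws.map Prod.snd) os) ^ 2 := by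
        positivity
      linarith
    · refine le_trans ?_ (hf0 os)
      have h2 : δ ^ 2 ≤ (-zeroMean N s M ws + zeroSum (ws.map Prod.snd) os) ^ 2 := by
        rw [neg_add_eq_sub, ← sq_abs (_ - _)]
        exact pow_le_pow_left₀ hδ.le (not_lt.1 h) 2
      have h3 : v / δ ^ 2 * δ ^ 2
          ≤ v / δ ^ 2 * (-zeroMean N s M ws + zeroSum (ws.map Prod.snd) os) ^ 2 := by gcongr
      rw [div_mul_cancel₀ _ (by positivity)] at h3
      linarith
  refine le_trans ?_ (expect_mono (ws.map Prod.fst) h1)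
  rw [expect_const_mul_add]
  have h4 := expect_zeroSum_sq_le (N := N) (s := s) (M := M) ws (-zeroMean N s M ws)
  have h5 : v / δ ^ 2 * expect N s M (ws.map Prod.fst)
      (fun os => (-zeroMean N s M ws + zeroSum (ws.map Prod.snd) os) ^ 2)
      ≤ v / δ ^ 2 * zeroVar N s M ws := by
    refine mul_le_mul_of_nonneg_left (h4.trans (by simp)) (by positivity)
  have h6 : v * (1 - zeroVar N s M ws / δ ^ 2) = v - v / δ ^ 2 * zeroVar N s M ws := by ring
  rw [h6]; linarith

theorem zeroSum_nonneg {as : List ℝ} (h : ∀ a ∈ as, 0 ≤ a) (os : List ℕ) :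
    0 ≤ zeroSum as os := by
  induction as generalizing os with
  | nil => simp [zeroSum]
  | cons a as ih =>
    rcases os with _ | ⟨o, os⟩
    · simp [zeroSum]
    · rw [zeroSum]
      have h1 := ih (fun b hb => h b (List.mem_cons_of_mem _ hb)) os
      have h2 := h a List.mem_cons_self
      split_ifs <;> linarith

/-- Markov's inequality for `zeroSum`. -/
theorem expect_ge_of_zeroSum_lt (ws : List (Circuit × ℝ)) {f : List ℕ → ℝ} {v τ : ℝ} (hτ : 0 < τ)
    (hv1 : v ≤ 1) (hws : ∀ x ∈ ws, 0 ≤ x.2) (hf0 : ∀ os, 0 ≤ f os)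
    (hf : ∀ os, zeroSum (ws.map Prod.snd) os < τ → v ≤ f os) :
    v - zeroMean N s M ws / τ ≤ expect N s M (ws.map Prod.fst) f := by
  have h1 : ∀ os, -(1 / τ) * zeroSum (ws.map Prod.snd) os + v ≤ f os := by
    intro os
    by_cases h : zeroSum (ws.map Prod.snd) os < τ
    · refine le_trans ?_ (hf os h)
      have : 0 ≤ 1 / τ * zeroSum (ws.map Prod.snd) os :=
        mul_nonneg (by positivity) (zeroSum_nonneg (by simpa using fun a C => hws (C, a)) os)
      linarith
    · refine le_trans ?_ (hf0 os)
      have : 1 / τ * τ ≤ 1 / τ * zeroSum (ws.map Prod.snd) os :=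
        mul_le_mul_of_nonneg_left (not_lt.1 h) (by positivity)
      rw [one_div_mul_cancel hτ.ne'] at this
      linarith
  refine le_trans (le_of_eq ?_) (expect_mono (ws.map Prod.fst) h1)
  rw [expect_const_mul_add, expect_zeroSum]; ring

end Expectation

/-! ### Success probability of adaptive controls -/

namespace QAlgorithm

variable {A : Type u} {B : Type v} {E : Type w} [Fintype E]

theorem haltProb_nonneg (alg : QAlgorithm) (N : Network A B E) (s : A) (M : Set (A ⊕ B))
    (P : ℝ → ℕ → Prop) (n : ℕ) (h : List ℕ) (t : ℕ) : 0 ≤ alg.haltProb N s M P n h t := by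
  induction n generalizing h t with
  | zero =>
    rw [haltProb]
    split
    · split_ifs <;> norm_num
    · exact le_rfl
  | succ n ih =>
    rw [haltProb]
    split
    · split_ifs <;> norm_num
    · exact Finset.sum_nonneg fun i _ =>
        mul_nonneg (Circuit.outcomeProb_nonneg _ N s M i) (ih _ _)

/-- Past outcomes can be absorbed into the control, which is what allows a run to be analysed
recursively. -/
theorem haltProb_append (alg : QAlgorithm) (N : Network A B E) (s : A) (M : Set (A ⊕ B))
    (P : ℝ → ℕ → Prop) (n : ℕ) (h h' : List ℕ) (t : ℕ) :
    alg.haltProb N s M P n (h ++ h') t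
      = haltProb (fun l => alg (l ++ h')) N s M P n h t := by
  induction n generalizing h t with
  | zero => simp only [haltProb]
  | succ n ih => simp only [haltProb, ← ih, List.cons_append]

/-- A control that runs a list of circuits and goes on as `k` says for the list of their outcomes,
the earliest one first. -/
def block : List Circuit → (List ℕ → List ℕ → NextAction) → List ℕ → NextAction
  | [], k, h => k [] h
  | C :: _, _, [] => .run C
  | _ :: cs, k, o :: h => block cs (fun os => k (o :: os)) h

theorem block_replicate (n : ℕ) (C : Circuit) (k : List ℕ → List ℕ → NextAction) (h : List ℕ) :
    block (List.replicate n C) k h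
      = if h.length < n then .run C else k (h.take n) (h.drop n) := by
  induction n generalizing k h with
  | zero => simp [block]
  | succ n ih =>
    rcases h with _ | ⟨o, h⟩
    · simp [List.replicate_succ, block]
    · rw [List.replicate_succ, block, ih]
      simp

/-- The success probability of a control that reads the outcomes with the earliest one first. -/
noncomputable def value (N : Network A B E) (s : A) (M : Set (A ⊕ B)) (P : ℝ → ℕ → Prop)
    (F : List ℕ → NextAction) (n t : ℕ) : ℝ :=
  haltProb (fun h => F h.reverse) N s M P n [] t

variable {N : Network A B E} {s : A} {M : Set (A ⊕ B)} {P : ℝ → ℕ → Prop}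

theorem value_nonneg (F : List ℕ → NextAction) (n t : ℕ) : 0 ≤ value N s M P F n t :=
  haltProb_nonneg _ _ _ _ _ _ _ _

theorem value_output {F : List ℕ → NextAction} {r : ℝ} (hF : F [] = .output r) {n t : ℕ}
    (h : P r t) : value N s M P F n t = 1 := by
  cases n <;> simp [value, haltProb, hF, h]

theorem value_run {F : List ℕ → NextAction} {C : Circuit} (hF : F [] = .run C) (n t : ℕ) :
    value N s M P F (n + 1) t = ∑ i : Fin (C.k + 1), C.outcomeProb N s M i
      * value N s M P (fun h => F (i.val :: h)) n (t + C.steps) := by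
  simp only [value, haltProb, List.reverse_nil, hF]
  refine Finset.sum_congr rfl fun i _ => ?_
  have := haltProb_append (fun h => F h.reverse) N s M P n [] [i.val] (t + C.steps)
  simp only [List.nil_append, List.reverse_append, List.reverse_cons, List.reverse_nil,
    List.singleton_append] at this
  rw [this]

theorem value_block (cs : List Circuit) (k : List ℕ → List ℕ → NextAction) (n t : ℕ) :
    value N s M P (block cs k) (cs.length + n) t
      = expect N s M cs
        (fun os => value N s M P (k os) n (t + (cs.map Circuit.steps).sum)) := by
  induction cs generalizing k t with
  | nil =>
    rw [List.length_nil, zero_add]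
    rfl
  | cons C cs ih =>
    rw [List.length_cons, show cs.length + 1 + n = cs.length + n + 1 by omega,
      value_run (C := C) rfl]
    simp only [block, expect]
    refine Finset.sum_congr rfl fun i _ => ?_
    rw [ih]
    simp only [List.map_cons, List.sum_cons, add_assoc]

end QAlgorithm

/-! ### The outcome probabilities of the circuits -/

namespace Network

variable {A : Type u} {B : Type v} {E : Type w} [Fintype E]

open Classical in
-- `1/R` is the Dirichlet energy of a potential with values in `[0, 1]`, hence at most `W`.
theorem one_le_effRes_mul_totalWeight (N : Network A B E) {s : A} {M : Set (A ⊕ B)}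
    (hs : Sum.inl s ∉ M) (hflow : ∃ p, N.IsUnitFlow s M p) :
    0 < N.effRes s M ∧ 1 ≤ N.effRes s M * N.totalWeight := by
  obtain ⟨u, -, -, hu, hR, hD, -⟩ := N.exists_potential hs hflow
  refine ⟨hR, ?_⟩
  have h : ∑ e, N.wt e * N.grad u e ^ 2 ≤ N.totalWeight := by
    refine Finset.sum_le_sum fun e _ => mul_le_of_le_one_right (N.wt_pos e).le ?_
    have h1 := hu (Sum.inl (N.src e))
    have h2 := hu (Sum.inr (N.tgt e))
    rw [sq_le_one_iff_abs_le_one, abs_le, grad]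
    constructor <;> linarith
  rw [hD, div_le_iff₀ hR] at h
  linarith

/-- The probability that the average of the first `T` powers of the walk operator is measured. -/
noncomputable def avgProb (N : Network A B E) (s : A) (M : Set (A ⊕ B)) (b : Bool)
    (η : Set.Ioi (0 : ℝ)) (T : ℕ) : ℝ :=
  ‖powAvg (N.walkAct s M b η) T (initState E)‖ ^ 2

variable (N : Network A B E) (s : A) (M : Set (A ⊕ B)) (b : Bool) (η : Set.Ioi (0 : ℝ))

theorem avgProb_one : N.avgProb s M b η 1 = 1 := by
  rw [avgProb, powAvg_one, initState, EuclideanSpace.norm_sq_eq]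
  simp [Fintype.sum_option]

theorem zeroProb_avgCircuit {T : ℕ} (hT : 0 < T) :
    zeroProb N s M (Circuit.avgCircuit b η T) = N.avgProb s M b η T :=
  Circuit.outcomeProb_avgCircuit N s M b η hT

theorem zeroProb_diffCircuit {T : ℕ} (hT : 0 < T) :
    zeroProb N s M (Circuit.diffCircuit b η T)
      = N.avgProb s M b η T - N.avgProb s M b η (2 * T) :=
  (Circuit.outcomeProb_diffCircuit N s M b η hT).trans
    (norm_powAvg_sq_sub (N.norm_walkAct s M b η) T _).symm

theorem sum_zeroProb_diffCircuit (l n : ℕ) :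
    ∑ i ∈ Finset.range n, zeroProb N s M (Circuit.diffCircuit b η (2 ^ (l + i)))
      = N.avgProb s M b η (2 ^ l) - N.avgProb s M b η (2 ^ (l + n)) := by
  rw [Finset.sum_congr rfl fun i _ => N.zeroProb_diffCircuit s M b η (T := 2 ^ (l + i))
    (by positivity)]
  induction n with
  | zero => simp
  | succ n ih =>
    rw [Finset.sum_range_succ, ih, ← pow_succ', Nat.add_assoc]; ring

variable {N s M}
variable (hs : Sum.inl s ∉ M) (hflow : ∃ p, N.IsUnitFlow s M p)
include hs hflow

theorem avgProb_true_bounds {T : ℕ} (hT : 0 < T) :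
    N.avgProb s M true η T ≤ ((η : ℝ) + N.effRes s M) / (η * T ^ 2) ∧
    1 - 4 * (T * (Real.sqrt η / Real.sqrt (N.effRes s M))
      + Real.sqrt η * Real.sqrt N.totalWeight) ≤ N.avgProb s M true η T := by
  obtain ⟨D⟩ := N.exists_walkData hs hflow η
  have h1 := D.norm_powAvg_le hT
  have h2 := D.le_norm_powAvg hT
  rw [← matAct_mul, ← matAct_mul] at h1 h2
  rw [Real.sq_sqrt η.2.le] at h1
  refine ⟨h1, ?_⟩
  -- Passing from the norm to its square by `x² ≥ 2x - 1` doubles the error, hence the constant `4`.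
  have h3 : ∀ x : ℝ, 2 * x - 1 ≤ x ^ 2 := fun x => by nlinarith [sq_nonneg (x - 1)]
  refine le_trans ?_ (h3 _)
  have h4 : ‖powAvg (N.walkAct s M true η) T (initState E)‖
    = ‖powAvg (matAct ((N.augment s η).reflA (Sum.map id some '' M ∪ {Sum.inr none})
      * (N.augment s η).reflB (Sum.map id some '' M ∪ {Sum.inr none}) * initSign E true)) T
        (initState E)‖ := rfl
  rw [h4]
  unfold initState
  linarith

theorem avgProb_false_bounds {T : ℕ} (hT : 0 < T) :
    (η : ℝ) / (η + N.effRes s M) ≤ N.avgProb s M false η T ∧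
    N.avgProb s M false η T
      ≤ (η : ℝ) / (η + N.effRes s M) + (η * N.totalWeight + 1) / T ^ 2 := by
  classical
  obtain ⟨D⟩ := N.exists_walkData hs hflow η
  obtain ⟨g, y, h1, h2, h3, h4, h5⟩ := D.exists_decomp
  have hw : N.walkAct s M false η
      = matAct ((N.augment s η).reflA (Sum.map id some '' M ∪ {Sum.inr none}))
        * matAct ((N.augment s η).reflB (Sum.map id some '' M ∪ {Sum.inr none})) := by
    rw [← matAct_mul, walkAct]
    congr 1
    have : initSign E false = 1 := by simp [initSign]
    rw [this, Matrix.mul_one]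
    rfl
  rw [← hw] at h1 h2 h3
  rw [Real.sq_sqrt η.2.le] at h4 h5
  have h6 := norm_sq_powAvg_add_fixed (N.norm_walkAct s M false η) hT.ne' h2 h3
  have h7 := norm_powAvg_coboundary_le (N.norm_walkAct s M false η) hT y
  have h8 : N.avgProb s M false η T = (η : ℝ) / (η + N.effRes s M)
      + ‖powAvg (N.walkAct s M false η) T (y - N.walkAct s M false η y)‖ ^ 2 := by
    rw [← h4, ← h6, ← h1]; rfl
  have h9 : ‖powAvg (N.walkAct s M false η) T (y - N.walkAct s M false η y)‖ ^ 2
      ≤ (η * N.totalWeight + 1) / T ^ 2 := by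
    calc _ ≤ (2 * ‖y‖ / T) ^ 2 := by gcongr
      _ = 4 * ‖y‖ ^ 2 / T ^ 2 := by rw [div_pow, mul_pow]; norm_num
      _ ≤ _ := by gcongr
  rw [h8]
  constructor
  · have := sq_nonneg ‖powAvg (N.walkAct s M false η) T (y - N.walkAct s M false η y)‖
    linarith
  · linarith

end Network

/-! ### The search for the scale of the resistance -/

theorem sum_map_flatMap_range {α β : Type*} [AddCommMonoid β] (g : ℕ → List α) (φ : α → β)
    (n : ℕ) : (((List.range n).flatMap g).map φ).sum
      = ∑ i ∈ Finset.range n, ((g i).map φ).sum := by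
  induction n with
  | zero => rfl
  | succ n ih =>
    rw [List.range_succ, List.flatMap_append, List.map_append, List.sum_append, ih,
      Finset.sum_range_succ]
    simp

namespace QAlgorithm

/-- Run `C l` for `l, l + 1, …`, each `2048` times, until a fraction `1 / 64` of the outcomes of
`C l` is `0`; then go on with `K l`. -/
noncomputable def search (C : ℕ → Circuit) (K : ℕ → List ℕ → NextAction) (l : ℕ)
    (h : List ℕ) : NextAction :=
  if h.length < 2048 then .run (C l)
  else if 1 / 64 ≤ zeroSum (List.replicate 2048 (1 / 2048)) (h.take 2048) then K l (h.drop 2048)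
  else search C K (l + 1) (h.drop 2048)
termination_by h.length
decreasing_by simp; omega

theorem search_eq_block (C : ℕ → Circuit) (K : ℕ → List ℕ → NextAction) (l : ℕ) :
    search C K l = block (List.replicate 2048 (C l)) fun os =>
      if 1 / 64 ≤ zeroSum (List.replicate 2048 (1 / 2048)) os then K l
      else search C K (l + 1) := by
  funext h
  rw [search, block_replicate]
  split_ifs <;> rfl

variable {A : Type u} {B : Type v} {E : Type w} [Fintype E]
  {N : Network A B E} {s : A} {M : Set (A ⊕ B)} {P : ℝ → ℕ → Prop}

theorem value_search (C : ℕ → Circuit) (K : ℕ → List ℕ → NextAction) (l n t : ℕ) :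
    value N s M P (search C K l) (2048 + n) t
      = expect N s M (List.replicate 2048 (C l)) fun os =>
        value N s M P (if 1 / 64 ≤ zeroSum (List.replicate 2048 (1 / 2048)) os then K l
          else search C K (l + 1)) n (t + 2048 * (C l).steps) := by
  have := value_block (N := N) (s := s) (M := M) (P := P) (List.replicate 2048 (C l))
    (fun os => if 1 / 64 ≤ zeroSum (List.replicate 2048 (1 / 2048)) os then K l
      else search C K (l + 1)) n t
  rw [← search_eq_block, List.length_replicate, List.map_replicate, List.sum_replicate,
    smul_eq_mul] at this
  exact this

/-- Stopping anywhere in the window `[a, m]` is good, so there only the failure to stop at `m` costs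
anything. Before `a` each scale is passed correctly up to a Markov error of `64` times its
probability; these errors add. Runs beyond `m` are counted as failures. The threshold `1/64` is half
of the guaranteed `1/32` at `m`. -/
theorem exists_le_value_search {C : ℕ → Circuit} {K : ℕ → List ℕ → NextAction} {a m : ℕ} {v : ℝ}
    (hv0 : 0 ≤ v) (hv1 : v ≤ 1)
    (hK : ∀ l, a ≤ l → l ≤ m → ∃ n₀, ∀ n, n₀ ≤ n →
      v ≤ value N s M P (K l) n (∑ i ∈ Finset.range (l + 1), 2048 * (C i).steps))
    (ham : a ≤ m) (hm : 1 / 32 ≤ zeroProb N s M (C m)) :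
    ∃ n, v * (15 / 16) - 64 * ∑ i ∈ Finset.range a, zeroProb N s M (C i)
      ≤ value N s M P (search C K 0) n 0 := by
  set t : ℕ → ℕ := fun l => ∑ i ∈ Finset.range l, 2048 * (C i).steps with ht
  have htl : ∀ l, t l + 2048 * (C l).steps = t (l + 1) := fun l =>
    (Finset.sum_range_succ _ _).symm
  set ws : ℕ → List (Circuit × ℝ) := fun l => List.replicate 2048 (C l, 1 / 2048) with hws
  have hfst : ∀ l, (ws l).map Prod.fst = List.replicate 2048 (C l) := fun l => List.map_replicate
  have hsnd : ∀ l, (ws l).map Prod.snd = List.replicate 2048 (1 / 2048 : ℝ) := fun l =>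
    List.map_replicate
  have hmean : ∀ l, zeroMean N s M (ws l) = zeroProb N s M (C l) := fun l => by
    simp only [zeroMean, hws, List.map_replicate, List.sum_replicate, nsmul_eq_mul]
    push_cast
    ring
  have hvar : ∀ l, zeroVar N s M (ws l) = zeroProb N s M (C l) / 2048 := fun l => by
    simp only [zeroVar, hws, List.map_replicate, List.sum_replicate, nsmul_eq_mul]
    push_cast
    ring
  -- Backward induction from `m`. Both branches of the test are good, so no probability is lost
  -- before `m`.
  have hwin : ∀ k, k ≤ m - a → ∃ n₀, ∀ n, n₀ ≤ n →
      v * (15 / 16) ≤ value N s M P (search C K (m - k)) n (t (m - k)) := by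
    intro k
    induction k with
    | zero =>
      intro _
      obtain ⟨n₀, hn₀⟩ := hK m ham le_rfl
      refine ⟨2048 + n₀, fun n hn => ?_⟩
      obtain ⟨n, rfl⟩ := Nat.exists_eq_add_of_le (le_of_add_le_left hn)
      rw [Nat.sub_zero, value_search, htl, ← hfst]
      have hq : 0 < zeroProb N s M (C m) := lt_of_lt_of_le (by norm_num) hm
      refine le_trans ?_ (expect_ge_of_zeroSum (ws m) (v := v) (half_pos hq) hv0
        (fun os => value_nonneg _ _ _) fun os hos => ?_)
      · refine mul_le_mul_of_nonneg_left ?_ hv0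
        -- Chebyshev with deviation half the mean fails with probability at most `1/(512 q) ≤ 1/16`,
        -- as `q ≥ 1/32`.
        have e : zeroProb N s M (C m) / 2048 / (zeroProb N s M (C m) / 2) ^ 2
            = 1 / (512 * zeroProb N s M (C m)) := by field_simp; norm_num
        rw [hvar, e]
        have : 1 / (512 * zeroProb N s M (C m)) ≤ 1 / 16 :=
          one_div_le_one_div_of_le (by norm_num) (by linarith)
        linarith
      · rw [hsnd, hmean, abs_lt] at hos
        rw [if_pos (by linarith)]
        exact hn₀ n (by omega)
    | succ k ih =>
      intro hk
      obtain ⟨n₁, hn₁⟩ := ih (by omega)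
      obtain ⟨n₀, hn₀⟩ := hK (m - (k + 1)) (by omega) (by omega)
      have hl : m - (k + 1) + 1 = m - k := by omega
      refine ⟨2048 + max n₀ n₁, fun n hn => ?_⟩
      obtain ⟨n, rfl⟩ := Nat.exists_eq_add_of_le (le_of_add_le_left hn)
      rw [value_search, htl, hl, ← expect_const (N := N) (s := s) (M := M)
        (List.replicate 2048 (C (m - (k + 1)))) (v * (15 / 16))]
      refine expect_mono _ fun os => ?_
      split_ifs
      · refine le_trans (by linarith) (hn₀ n (by omega)) |>.trans (le_of_eq ?_)
        rw [hl]
      · exact hn₁ n (by omega)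
  -- Backward induction from `a` to `0`, with one Markov bound per scale.
  have hpre : ∀ k, k ≤ a → ∃ n₀, ∀ n, n₀ ≤ n →
      v * (15 / 16) - 64 * ∑ i ∈ Finset.Ico (a - k) a, zeroProb N s M (C i)
        ≤ value N s M P (search C K (a - k)) n (t (a - k)) := by
    intro k
    induction k with
    | zero =>
      intro _
      obtain ⟨n₀, hn₀⟩ := hwin (m - a) le_rfl
      have : m - (m - a) = a := by omega
      rw [this] at hn₀
      exact ⟨n₀, fun n hn => by simpa using hn₀ n hn⟩
    | succ k ih =>
      intro hk
      obtain ⟨n₁, hn₁⟩ := ih (by omega)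
      have hl : a - (k + 1) + 1 = a - k := by omega
      refine ⟨2048 + n₁, fun n hn => ?_⟩
      obtain ⟨n, rfl⟩ := Nat.exists_eq_add_of_le (le_of_add_le_left hn)
      have hnn : 0 ≤ ∑ i ∈ Finset.Ico (a - k) a, zeroProb N s M (C i) :=
        Finset.sum_nonneg fun i _ => zeroProb_nonneg _
      rw [value_search, htl, hl, ← hfst]
      refine le_trans ?_ (expect_ge_of_zeroSum_lt (ws (a - (k + 1)))
        (v := v * (15 / 16) - 64 * ∑ i ∈ Finset.Ico (a - k) a, zeroProb N s M (C i))
        (τ := 1 / 64) (by norm_num) (by linarith)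
        (fun x hx => by rw [List.eq_of_mem_replicate hx]; norm_num)
        (fun os => value_nonneg _ _ _) fun os hos => ?_)
      · rw [Finset.sum_eq_sum_Ico_succ_bot (by omega), hl, hmean]
        apply le_of_eq; ring
      · rw [hsnd] at hos
        rw [if_neg (not_le.2 hos)]
        exact hn₁ n (by omega)
  obtain ⟨n, hn⟩ := hpre a le_rfl
  refine ⟨n, ?_⟩
  have := hn n le_rfl
  rw [Nat.sub_self, Nat.Ico_zero_eq_range] at this
  simpa [ht] using this

end QAlgorithm

/-! ### The estimation at a known scale -/

section Estimate

/-- The number of samples at the depth `i`. -/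
noncomputable def sampleCount (κ ε : ℝ) (i : ℕ) : ℕ := ⌈κ / (ε ^ 2 * 3 ^ i)⌉₊

/-- The circuits of the multilevel estimator, with the coefficients of their outcomes `0`. -/
noncomputable def estimator (κ ε : ℝ) (η : Set.Ioi (0 : ℝ)) (l L : ℕ) : List (Circuit × ℝ) :=
  List.replicate (sampleCount κ ε 0)
    (Circuit.avgCircuit false η (2 ^ l), 1 / (sampleCount κ ε 0 : ℝ)) ++
  (List.range L).flatMap fun i => List.replicate (sampleCount κ ε i)
    (Circuit.diffCircuit false η (2 ^ (l + i)), -(1 / (sampleCount κ ε i : ℝ)))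

variable {A : Type u} {B : Type v} {E : Type w} [Fintype E]
  {N : Network A B E} {s : A} {M : Set (A ⊕ B)} {κ ε : ℝ} {η : Set.Ioi (0 : ℝ)} {l L : ℕ}

theorem sampleCount_pos (hκ : 0 < κ) (hε : 0 < ε) (i : ℕ) : (0 : ℝ) < sampleCount κ ε i := by
  have : 0 < sampleCount κ ε i := Nat.ceil_pos.2 (by positivity)
  exact_mod_cast this

theorem inv_sampleCount_le (hκ : 0 < κ) (hε : 0 < ε) (i : ℕ) :
    1 / (sampleCount κ ε i : ℝ) ≤ ε ^ 2 * 3 ^ i / κ := by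
  have h : κ / (ε ^ 2 * 3 ^ i) ≤ sampleCount κ ε i := Nat.le_ceil _
  calc 1 / (sampleCount κ ε i : ℝ) ≤ 1 / (κ / (ε ^ 2 * 3 ^ i)) :=
        one_div_le_one_div_of_le (by positivity) h
    _ = _ := one_div_div _ _

/-- The mean telescopes: the average at the coarsest level minus all later drops is the average at
the finest level. -/
theorem zeroMean_estimator (hκ : 0 < κ) (hε : 0 < ε) :
    zeroMean N s M (estimator κ ε η l L) = N.avgProb s M false η (2 ^ (l + L)) := by
  have h := fun i => (sampleCount_pos hκ hε i).ne'
  rw [zeroMean, estimator, List.map_append, List.sum_append, sum_map_flatMap_range]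
  simp only [List.map_replicate, List.sum_replicate, nsmul_eq_mul]
  have h1 : ∀ i, (sampleCount κ ε i : ℝ) * (-(1 / (sampleCount κ ε i : ℝ))
      * zeroProb N s M (Circuit.diffCircuit false η (2 ^ (l + i))))
      = -zeroProb N s M (Circuit.diffCircuit false η (2 ^ (l + i))) := fun i => by
    have := h i
    field_simp
  rw [Finset.sum_congr rfl fun i _ => h1 i, Finset.sum_neg_distrib,
    N.sum_zeroProb_diffCircuit, N.zeroProb_avgCircuit s M false η (by positivity)]
  have := h 0
  field_simp
  ring

/-- All averages lie in a window of width `(ηW + 1)/T²` above the same limit, so the drop at depth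
`i` is at most `2/4^i`. Against `3^i` from the sample numbers this sums geometrically with ratio
`3/4`. -/
theorem zeroVar_estimator_le (hκ : 0 < κ) (hε : 0 < ε) (hs : Sum.inl s ∉ M)
    (hflow : ∃ p, N.IsUnitFlow s M p) (hη : (η : ℝ) * N.totalWeight + 1 ≤ 2 * 4 ^ l) :
    zeroVar N s M (estimator κ ε η l L) ≤ 9 * ε ^ 2 / κ := by
  have h := sampleCount_pos hκ hε
  have hp : ∀ i, zeroProb N s M (Circuit.diffCircuit false η (2 ^ (l + i))) ≤ 2 / 4 ^ i := by
    intro i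
    rw [N.zeroProb_diffCircuit s M false η (by positivity)]
    have h1 := (Network.avgProb_false_bounds η hs hflow (T := 2 ^ (l + i)) (by positivity)).2
    have h2 := (Network.avgProb_false_bounds η hs hflow (T := 2 * 2 ^ (l + i)) (by positivity)).1
    have h3 : ((η : ℝ) * N.totalWeight + 1) / ((2 ^ (l + i) : ℕ) : ℝ) ^ 2 ≤ 2 / 4 ^ i := by
      have e : (((2 ^ (l + i) : ℕ) : ℝ)) ^ 2 = 4 ^ l * 4 ^ i := by
        push_cast
        rw [← pow_mul, mul_comm, pow_mul, ← pow_add]; norm_num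
      rw [e, div_le_div_iff₀ (by positivity) (by positivity)]
      have : (0 : ℝ) < 4 ^ i := by positivity
      nlinarith
    linarith
  rw [zeroVar, estimator, List.map_append, List.sum_append, sum_map_flatMap_range]
  simp only [List.map_replicate, List.sum_replicate, nsmul_eq_mul]
  have h1 : ∀ (i : ℕ) (q : ℝ), (sampleCount κ ε i : ℝ) * ((1 / (sampleCount κ ε i : ℝ)) ^ 2 * q)
      = 1 / (sampleCount κ ε i : ℝ) * q := fun i q => by
    have := (h i).ne'
    field_simp
  simp only [neg_sq, h1]
  have h2 : 1 / (sampleCount κ ε 0 : ℝ)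
      * zeroProb N s M (Circuit.avgCircuit false η (2 ^ l)) ≤ ε ^ 2 / κ := by
    refine (mul_le_of_le_one_right (by positivity) (zeroProb_le_one _)).trans ?_
    simpa using inv_sampleCount_le hκ hε 0
  have h3 : ∀ i ∈ Finset.range L, 1 / (sampleCount κ ε i : ℝ)
      * zeroProb N s M (Circuit.diffCircuit false η (2 ^ (l + i)))
      ≤ 2 * ε ^ 2 / κ * (3 / 4) ^ i := fun i _ => by
    calc _ ≤ ε ^ 2 * 3 ^ i / κ * (2 / 4 ^ i) :=
          mul_le_mul (inv_sampleCount_le hκ hε i) (hp i) (zeroProb_nonneg _) (by positivity)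
      _ = _ := by rw [div_pow]; ring
  have h4 : ∑ i ∈ Finset.range L, (3 / 4 : ℝ) ^ i ≤ 4 := by
    rw [geom_sum_eq (by norm_num)]
    have : (0 : ℝ) ≤ (3 / 4) ^ L := by positivity
    rw [div_le_iff_of_neg (by norm_num)]
    linarith
  refine (add_le_add h2 (Finset.sum_le_sum h3)).trans ?_
  rw [← Finset.mul_sum]
  have h5 : 2 * ε ^ 2 / κ * ∑ i ∈ Finset.range L, (3 / 4 : ℝ) ^ i ≤ 2 * ε ^ 2 / κ * 4 := by gcongr
  refine (add_le_add_right h5 _).trans (le_of_eq ?_)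
  ring

/-- A run at depth `i` costs at most `2 · 2^(l+i)`, so the cost is geometric with ratio `2/3`.
Rounding the sample numbers up adds at most one run per depth, hence the term `2 * 2 ^ L`. -/
theorem steps_estimator_le (hκ : 1 ≤ κ) (hε : 0 < ε) (hε1 : ε ≤ 1) :
    ((((estimator κ ε η l L).map Prod.fst).map Circuit.steps).sum : ℝ)
      ≤ 2 ^ l * (8 * κ / ε ^ 2 + 2 * 2 ^ L) := by
  have hc : ∀ i, (sampleCount κ ε i : ℝ) ≤ κ / ε ^ 2 * (1 / 3) ^ i + 1 := fun i => by
    refine (Nat.ceil_lt_add_one (by positivity)).le.trans (le_of_eq ?_)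
    rw [div_pow, one_pow]; field_simp
  have hge : 1 ≤ κ / ε ^ 2 := by
    rw [le_div_iff₀ (by positivity)]
    nlinarith
  have h1 : (((estimator κ ε η l L).map Prod.fst).map Circuit.steps).sum
      ≤ sampleCount κ ε 0 * 2 ^ l
        + ∑ i ∈ Finset.range L, sampleCount κ ε i * (2 * 2 ^ (l + i)) := by
    rw [List.map_map, estimator, List.map_append, List.sum_append, sum_map_flatMap_range]
    simp only [List.map_replicate, List.sum_replicate, smul_eq_mul, Function.comp]
    refine add_le_add (Nat.mul_le_mul_left _ (Circuit.steps_avgCircuit_le _ _ _))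
      (Finset.sum_le_sum fun i _ => Nat.mul_le_mul_left _ (Circuit.steps_diffCircuit_le _ _ _))
  have h2 : ((((estimator κ ε η l L).map Prod.fst).map Circuit.steps).sum : ℝ)
      ≤ sampleCount κ ε 0 * 2 ^ l
        + ∑ i ∈ Finset.range L, (sampleCount κ ε i : ℝ) * (2 * 2 ^ (l + i)) := by
    exact_mod_cast h1
  refine h2.trans ?_
  have h3 : ∀ i ∈ Finset.range L, (sampleCount κ ε i : ℝ) * (2 * 2 ^ (l + i))
      ≤ 2 ^ l * (2 * (κ / ε ^ 2)) * (2 / 3) ^ i + 2 ^ l * 2 * 2 ^ i := fun i _ => by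
    calc _ ≤ (κ / ε ^ 2 * (1 / 3) ^ i + 1) * (2 * 2 ^ (l + i)) := by gcongr; exact hc i
      _ = _ := by rw [pow_add, div_pow, div_pow]; ring
  have h4 : ∑ i ∈ Finset.range L, (2 / 3 : ℝ) ^ i ≤ 3 := by
    rw [geom_sum_eq (by norm_num)]
    have : (0 : ℝ) ≤ (2 / 3) ^ L := by positivity
    rw [div_le_iff_of_neg (by norm_num)]
    linarith
  have h5 : ∑ i ∈ Finset.range L, (2 : ℝ) ^ i ≤ 2 ^ L := by
    rw [geom_sum_eq (by norm_num)]; norm_num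
  have h6 := Finset.sum_le_sum h3
  rw [Finset.sum_add_distrib, ← Finset.mul_sum, ← Finset.mul_sum] at h6
  have h7 : (2 : ℝ) ^ l * (2 * (κ / ε ^ 2)) * ∑ i ∈ Finset.range L, (2 / 3 : ℝ) ^ i
      ≤ 2 ^ l * (2 * (κ / ε ^ 2)) * 3 := by gcongr
  have h8 : (2 : ℝ) ^ l * 2 * ∑ i ∈ Finset.range L, (2 : ℝ) ^ i ≤ 2 ^ l * 2 * 2 ^ L := by gcongr
  have h9 : (sampleCount κ ε 0 : ℝ) * 2 ^ l ≤ (κ / ε ^ 2 * 2) * 2 ^ l := by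
    gcongr
    have := hc 0
    rw [pow_zero, mul_one] at this
    linarith
  have e : (2 : ℝ) ^ l * (8 * κ / ε ^ 2 + 2 * 2 ^ L)
      = κ / ε ^ 2 * 2 * 2 ^ l + 2 ^ l * (2 * (κ / ε ^ 2)) * 3 + 2 ^ l * 2 * 2 ^ L := by ring
  rw [e]; linarith

/-- The resistance is stable under errors of the estimated probability `η / (η + R)`. -/
theorem abs_resistance_sub_le {η R c p : ℝ} (hη : 0 < η) (hR : 0 < R) (hc : 0 < c) (hε : 0 < ε)
    (hε1 : ε ≤ 1) (hc1 : c ≤ 1 / 10) (hRη : R ≤ 4 * η) (hηR : 50 * c * η ≤ R)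
    (hp : |p - η / (η + R)| ≤ c * ε) : |η * (1 / p - 1) - R| ≤ ε * R := by
  have hq : 1 / 5 ≤ η / (η + R) := by
    rw [div_le_div_iff₀ (by norm_num) (by positivity)]; linarith
  have hcε : c * ε ≤ 1 / 10 := by nlinarith
  have hp1 : 1 / 10 ≤ p := by linarith [(abs_le.1 hp).1]
  have hp0 : 0 < p := by linarith
  have h1 : η * (1 / p - 1) - R = -((p - η / (η + R)) * ((η + R) / p)) := by
    field_simp; ring
  -- From `η + R ≤ 5η` and `p ≥ 1/10`.
  have h2 : (η + R) / p ≤ 50 * η := by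
    rw [div_le_iff₀ hp0]; nlinarith
  rw [h1, abs_neg, abs_mul, abs_of_pos (show 0 < (η + R) / p by positivity)]
  calc _ ≤ c * ε * (50 * η) := mul_le_mul hp h2 (by positivity) (by positivity)
    _ = ε * (50 * c * η) := by ring
    _ ≤ ε * R := by gcongr

end Estimate

namespace QAlgorithm

/-- Run the estimator and output the estimate of the resistance. -/
noncomputable def estimate (κ ε : ℝ) (η : Set.Ioi (0 : ℝ)) (l L : ℕ) : List ℕ → NextAction :=
  block ((estimator κ ε η l L).map Prod.fst) fun os _ =>
    .output (η * (1 / zeroSum ((estimator κ ε η l L).map Prod.snd) os - 1))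

variable {A : Type u} {B : Type v} {E : Type w} [Fintype E]
  {N : Network A B E} {s : A} {M : Set (A ⊕ B)} {P : ℝ → ℕ → Prop}

/-- The allowed error `c ε` of the probability is split evenly between statistical error and bias.
Chebyshev with the variance bound `9ε²/κ` fails with probability at most `1/16` when `κ c² = 9 ·
64`. -/
theorem le_value_estimate {κ ε c : ℝ} {η : Set.Ioi (0 : ℝ)} {l L t n : ℕ} (hε : 0 < ε)
    (hε1 : ε ≤ 1) (hc : 0 < c) (hc1 : c ≤ 1 / 10) (hκ : κ * c ^ 2 = 576)
    (hs : Sum.inl s ∉ M) (hflow : ∃ p, N.IsUnitFlow s M p)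
    (hη : (η : ℝ) * N.totalWeight + 1 ≤ 2 * 4 ^ l) (hL : 4 / (c * ε) ≤ 2 ^ L)
    (hRη : N.effRes s M ≤ 4 * η) (hηR : 50 * c * η ≤ N.effRes s M)
    (hn : (estimator κ ε η l L).length ≤ n)
    (hP : ∀ r, |r - N.effRes s M| ≤ ε * N.effRes s M →
      P r (t + (((estimator κ ε η l L).map Prod.fst).map Circuit.steps).sum)) :
    15 / 16 ≤ value N s M P (estimate κ ε η l L) n t := by
  obtain ⟨n, rfl⟩ := Nat.exists_eq_add_of_le hn
  have hκ0 : 0 < κ := by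
    by_contra h
    nlinarith [sq_nonneg c]
  obtain ⟨hR, -⟩ := N.one_le_effRes_mul_totalWeight hs hflow
  have hη0 : (0 : ℝ) < η := η.2
  have hval := value_block (N := N) (s := s) (M := M) (P := P)
    ((estimator κ ε η l L).map Prod.fst)
    (fun os _ => .output (η * (1 / zeroSum ((estimator κ ε η l L).map Prod.snd) os - 1))) n t
  rw [List.length_map] at hval
  rw [estimate, hval]
  have hδ : 0 < c * ε / 2 := by positivity
  refine le_trans ?_ (expect_ge_of_zeroSum (estimator κ ε η l L) (v := 1) hδ zero_le_one
    (fun os => value_nonneg _ _ _) fun os hos => (value_output rfl (hP _ ?_)).ge)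
  · have h1 := zeroVar_estimator_le (L := L) hκ0 hε hs hflow hη
    have h2 : zeroVar N s M (estimator κ ε η l L) / (c * ε / 2) ^ 2 ≤ 1 / 16 := by
      rw [div_le_iff₀ (by positivity)]
      refine h1.trans ?_
      rw [div_le_iff₀ hκ0]
      have e : 1 / 16 * (c * ε / 2) ^ 2 * κ = κ * c ^ 2 * ε ^ 2 / 64 := by ring
      rw [e, hκ]
      apply le_of_eq; ring
    linarith
  · rw [zeroMean_estimator hκ0 hε] at hos
    obtain ⟨h1, h2⟩ := Network.avgProb_false_bounds η hs hflow (T := 2 ^ (l + L)) (by positivity)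
    -- The bias is at most `2/4^L`. Spending only one factor `2^L` on `1/ε` is wasteful, but such
    -- depths cost `O(1/ε)` and are dominated by the sampling.
    have h3 : ((η : ℝ) * N.totalWeight + 1) / ((2 ^ (l + L) : ℕ) : ℝ) ^ 2 ≤ c * ε / 2 := by
      have e : (((2 ^ (l + L) : ℕ) : ℝ)) ^ 2 = 4 ^ l * (2 ^ L * 2 ^ L) := by
        push_cast
        rw [pow_add, mul_pow, ← pow_mul, mul_comm l, pow_mul, pow_two (2 ^ L : ℝ)]; norm_num
      have hL1 : (1 : ℝ) ≤ 2 ^ L := one_le_pow₀ (by norm_num)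
      have hL2 : 4 ≤ c * ε * 2 ^ L := by
        rwa [div_le_iff₀ (by positivity), mul_comm] at hL
      rw [e, div_le_iff₀ (by positivity)]
      have h4 : (0 : ℝ) < 4 ^ l := by positivity
      calc (η : ℝ) * N.totalWeight + 1 ≤ 2 * 4 ^ l := hη
        _ = 4 ^ l * (1 * 4 / 2) := by ring
        _ ≤ 4 ^ l * (2 ^ L * (c * ε * 2 ^ L) / 2) := by gcongr
        _ = _ := by ring
    refine abs_resistance_sub_le hη0 hR hc hε hε1 hc1 hRη hηR ?_
    rw [abs_lt] at hos
    rw [abs_le]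
    constructor <;> linarith [hos.1, hos.2]

end QAlgorithm

/-! ### Locating the drop, and assembling the algorithm -/

theorem exists_scale {A : Type u} {B : Type v} {E : Type w} [Fintype E]
    {N : Network A B E} {s : A} {M : Set (A ⊕ B)} (hs : Sum.inl s ∉ M)
    (hflow : ∃ p, N.IsUnitFlow s M p) {W' : ℝ} (hW : N.totalWeight ≤ W') (hW' : 0 < W')
    {η : Set.Ioi (0 : ℝ)} (hη : (η : ℝ) = (1 / 2 ^ 13) ^ 2 / W') :
    ∃ a m : ℕ, a ≤ m ∧ m < a + 16 ∧ 2 ^ a ≤ Real.sqrt (N.effRes s M * W') ∧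
      Real.sqrt (N.effRes s M * W') < 2 ^ (a + 1) ∧
      ∑ i ∈ Finset.range a, zeroProb N s M (Circuit.diffCircuit true η (2 ^ i)) ≤ 1 / 1024 ∧
      1 / 32 ≤ zeroProb N s M (Circuit.diffCircuit true η (2 ^ m)) := by
  obtain ⟨hR, hRW⟩ := N.one_le_effRes_mul_totalWeight hs hflow
  set R := N.effRes s M with hRdef
  have hRW' : 1 ≤ R * W' := hRW.trans (mul_le_mul_of_nonneg_left hW hR.le)
  set X := Real.sqrt (R * W') with hX
  have hX1 : 1 ≤ X := Real.one_le_sqrt.2 hRW'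
  have hX2 : X ^ 2 = R * W' := Real.sq_sqrt (by positivity)
  obtain ⟨a, ha1, ha2⟩ := exists_nat_pow_near hX1 (one_lt_two)
  have hsη : Real.sqrt η = (1 / 2 ^ 13) / Real.sqrt W' := by
    rw [hη, Real.sqrt_div (by positivity), Real.sqrt_sq (by positivity)]
  have hsW : 0 < Real.sqrt W' := Real.sqrt_pos.2 hW'
  have hsR : 0 < Real.sqrt R := Real.sqrt_pos.2 hR
  -- At `T = 2^a ≤ √(R W')` both error terms are at most `2^{-13}`, and `4 · 2 · 2^{-13} = 1/1024`.
  have hlow : 1 - 1 / 1024 ≤ N.avgProb s M true η (2 ^ a) := by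
    refine le_trans ?_ (Network.avgProb_true_bounds η hs hflow (T := 2 ^ a) (by positivity)).2
    have h1 : ((2 ^ a : ℕ) : ℝ) * (Real.sqrt η / Real.sqrt R) ≤ 1 / 2 ^ 13 := by
      calc ((2 ^ a : ℕ) : ℝ) * (Real.sqrt η / Real.sqrt R) ≤ X * (Real.sqrt η / Real.sqrt R) := by
            push_cast; gcongr
        _ = 1 / 2 ^ 13 := by
            rw [hX, hsη, Real.sqrt_mul hR.le]; field_simp
    have h2 : Real.sqrt η * Real.sqrt N.totalWeight ≤ 1 / 2 ^ 13 := by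
      calc Real.sqrt η * Real.sqrt N.totalWeight ≤ Real.sqrt η * Real.sqrt W' := by gcongr
        _ = _ := by rw [hsη]; field_simp
    norm_num at h1 h2 ⊢
    linarith
  have hhigh : N.avgProb s M true η (2 ^ (a + 16)) ≤ 1 / 8 := by
    refine (Network.avgProb_true_bounds η hs hflow (T := 2 ^ (a + 16)) (by positivity)).1.trans ?_
    have hY : X ^ 2 ≤ (2 ^ (a + 1)) ^ 2 := by gcongr
    have hY1 : (1 : ℝ) ≤ (2 ^ (a + 1)) ^ 2 := one_le_pow₀ (one_le_pow₀ one_le_two)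
    have e : ((2 ^ (a + 16) : ℕ) : ℝ) ^ 2 = 2 ^ 30 * (2 ^ (a + 1)) ^ 2 := by
      push_cast; rw [pow_add, pow_add]; ring
    set Y : ℝ := (2 ^ (a + 1)) ^ 2
    have hR2 : R = X ^ 2 / W' := by rw [hX2]; field_simp
    rw [← hRdef, e, hη, hR2, div_le_iff₀ (by positivity)]
    have e2 : 1 / 8 * ((1 / 2 ^ 13) ^ 2 / W' * (2 ^ 30 * Y)) = 2 * Y / W' := by
      field_simp; norm_num
    rw [e2, ← add_div]
    refine div_le_div_of_nonneg_right ?_ hW'.le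
    norm_num
    linarith
  have hsum := N.sum_zeroProb_diffCircuit s M true η a 16
  -- Pigeonhole: the probability falls by at least `1 - 1/1024 - 1/8` over `16` doublings, which
  -- exceeds `16 · (1/32)`.
  have hex : ∃ i ∈ Finset.range 16,
      1 / 32 ≤ zeroProb N s M (Circuit.diffCircuit true η (2 ^ (a + i))) := by
    by_contra! h
    have := Finset.sum_le_sum fun i hi => (h i hi).le
    rw [hsum] at this
    norm_num at this hlow hhigh
    linarith
  obtain ⟨i, hi, hq⟩ := hex
  have hpre := N.sum_zeroProb_diffCircuit s M true η 0 a
  simp only [zero_add, pow_zero, N.avgProb_one] at hpre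
  refine ⟨a, a + i, Nat.le_add_right _ _, by simpa using hi, ha1, ha2, ?_, hq⟩
  rw [hpre]
  linarith

theorem theorem2 :
    ∃ C : ℝ, 0 < C ∧ ∀ W' ε : ℝ, 0 < ε →
      ∃ alg : QAlgorithm,
        ∀ (A : Type u) (B : Type v) (E : Type w) [Fintype E]
          (N : Network A B E) (s : A) (M : Set (A ⊕ B)),
          N.totalWeight ≤ W' →
          Sum.inl s ∉ M →
          (∃ p : E → ℝ, N.IsUnitFlow s M p) →
          ∃ n : ℕ, (2 / 3 : ℝ) ≤ alg.haltProb N s M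
            (fun r T => |r - N.effRes s M| ≤ ε * N.effRes s M ∧
              (T : ℝ) ≤ C * (Real.sqrt (N.effRes s M * W') / ε ^ 2)) n [] 0 := by
  -- The search may overshoot to `2^l ≤ 2^15 √(R W')`, so `η ≤ 2^30 R`; `c` is chosen so that `50 c
  -- · 2^30 ≤ 1`.
  obtain ⟨c, hc⟩ : ∃ c : ℝ, c = 1 / 2 ^ 36 := ⟨_, rfl⟩
  have hc0 : 0 < c := by rw [hc]; positivity
  have hc1 : c ≤ 1 / 10 := by rw [hc]; norm_num
  obtain ⟨κ, hκ⟩ : ∃ κ : ℝ, κ = 576 / c ^ 2 := ⟨_, rfl⟩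
  have hκ2 : κ * c ^ 2 = 576 := by rw [hκ]; field_simp
  have hκ1 : 1 ≤ κ := by
    rw [hκ, le_div_iff₀ (by positivity)]
    nlinarith
  refine ⟨2 ^ 15 * (8192 + 8 * κ + 16 / c), by positivity, fun W' ε hε => ?_⟩
  -- For `ε ≥ 1` the output `0` is accurate enough. For `W' ≤ 0` there is no admissible graph, since
  -- `R W ≥ 1`.
  rcases le_or_gt 1 ε with hε1 | hε1
  · refine ⟨fun _ => .output 0, fun A B E _ N s M hW hs hflow => ⟨0, ?_⟩⟩
    obtain ⟨hR, -⟩ := N.one_le_effRes_mul_totalWeight hs hflow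
    simp only [QAlgorithm.haltProb]
    rw [if_pos]
    · norm_num
    · refine ⟨?_, ?_⟩
      · rw [zero_sub, abs_neg, abs_of_pos hR]
        exact le_mul_of_one_le_left hR.le hε1
      · rw [Nat.cast_zero]; positivity
  rcases le_or_gt W' 0 with hW' | hW'
  · refine ⟨fun _ => .output 0, fun A B E _ N s M hW hs hflow => ?_⟩
    obtain ⟨hR, hRW⟩ := N.one_le_effRes_mul_totalWeight hs hflow
    nlinarith
  -- Depth `L + 1` is used: `2^(L+1)` exceeds `4/(cε)`, as the bias requires, while `2^L` does not,
  -- as the cost requires.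
  obtain ⟨L, hL1, hL2⟩ := exists_nat_pow_near (x := 4 / (c * ε)) (y := 2) (by
    rw [le_div_iff₀ (by positivity)]; nlinarith) one_lt_two
  let η₁ : Set.Ioi (0 : ℝ) := ⟨(1 / 2 ^ 13) ^ 2 / W', div_pos (by positivity) hW'⟩
  -- As `2^l` is comparable to `√(R W')`, this `η` is comparable to `R`.
  let η : ℕ → Set.Ioi (0 : ℝ) := fun l => ⟨4 ^ l / W', div_pos (by positivity) hW'⟩
  refine ⟨fun h => QAlgorithm.search (fun l => Circuit.diffCircuit true η₁ (2 ^ l))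
    (fun l => QAlgorithm.estimate κ ε (η l) l (L + 1)) 0 h.reverse,
    fun A B E _ N s M hW hs hflow => ?_⟩
  obtain ⟨hR, hRW⟩ := N.one_le_effRes_mul_totalWeight hs hflow
  obtain ⟨a, m, ham, hma, ha1, ha2, hpre, hm⟩ := exists_scale hs hflow hW hW' (η := η₁) rfl
  set R := N.effRes s M with hRdef
  set X := Real.sqrt (R * W') with hX
  have hX2 : X ^ 2 = R * W' := Real.sq_sqrt (by positivity)
  have hX0 : 0 ≤ X := Real.sqrt_nonneg _
  have hX0' : (0 : ℝ) < 2 ^ a := by positivity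
  let P : ℝ → ℕ → Prop := fun r T => |r - R| ≤ ε * R ∧
    (T : ℝ) ≤ 2 ^ 15 * (8192 + 8 * κ + 16 / c) * (X / ε ^ 2)
  have hK : ∀ l, a ≤ l → l ≤ m → ∃ n₀, ∀ n, n₀ ≤ n →
      15 / 16 ≤ QAlgorithm.value N s M P (QAlgorithm.estimate κ ε (η l) l (L + 1)) n
        (∑ i ∈ Finset.range (l + 1), 2048 * (Circuit.diffCircuit true η₁ (2 ^ i)).steps) := by
    intro l hal hlm
    refine ⟨(estimator κ ε (η l) l (L + 1)).length, fun n hn =>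
      QAlgorithm.le_value_estimate hε hε1.le hc0 hc1 hκ2 hs hflow ?_ hL2.le ?_ ?_ hn
        fun r hr => ⟨hr, ?_⟩⟩
    · change 4 ^ l / W' * N.totalWeight + 1 ≤ 2 * 4 ^ l
      have h1 : (4 : ℝ) ^ l / W' * N.totalWeight ≤ 4 ^ l / W' * W' := by gcongr
      rw [div_mul_cancel₀ _ hW'.ne'] at h1
      have h2 : (1 : ℝ) ≤ 4 ^ l := one_le_pow₀ (by norm_num)
      linarith
    · change R ≤ 4 * (4 ^ l / W')
      have h1 : X ^ 2 ≤ (2 ^ (l + 1)) ^ 2 := by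
        refine pow_le_pow_left₀ hX0 (ha2.le.trans ?_) 2
        exact pow_le_pow_right₀ one_le_two (by omega)
      have e : ((2 : ℝ) ^ (l + 1)) ^ 2 = 4 * 4 ^ l := by
        rw [← pow_mul, mul_comm, pow_mul]; norm_num [pow_succ]; ring
      rw [hX2, e] at h1
      rw [mul_div_assoc', le_div_iff₀ hW']
      exact h1
    · change 50 * c * (4 ^ l / W') ≤ R
      have h1 : (2 : ℝ) ^ l ≤ 2 ^ 15 * X := by
        calc (2 : ℝ) ^ l ≤ 2 ^ (15 + a) := pow_le_pow_right₀ one_le_two (by omega)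
          _ = 2 ^ 15 * 2 ^ a := pow_add _ _ _
          _ ≤ _ := by gcongr
      have h2 : (4 : ℝ) ^ l ≤ 2 ^ 30 * (R * W') := by
        calc (4 : ℝ) ^ l = (2 ^ l) ^ 2 := by rw [← pow_mul, mul_comm, pow_mul]; norm_num
          _ ≤ (2 ^ 15 * X) ^ 2 := by gcongr
          _ = 2 ^ 30 * (R * W') := by rw [mul_pow, hX2]; norm_num
      have h3 : 0 < R * W' := by positivity
      rw [mul_div_assoc', div_le_iff₀ hW', hc]
      linarith
    · have h1 : (2 : ℝ) ^ l ≤ 2 ^ 15 * X := by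
        calc (2 : ℝ) ^ l ≤ 2 ^ (15 + a) := pow_le_pow_right₀ one_le_two (by omega)
          _ = 2 ^ 15 * 2 ^ a := pow_add _ _ _
          _ ≤ _ := by gcongr
      -- The doubling search costs a constant multiple of its last scale.
      have h2 : ((∑ i ∈ Finset.range (l + 1),
          2048 * (Circuit.diffCircuit true η₁ (2 ^ i)).steps : ℕ) : ℝ) ≤ 8192 * 2 ^ l := by
        have h3 : ∑ i ∈ Finset.range (l + 1), 2048 * (Circuit.diffCircuit true η₁ (2 ^ i)).steps
            ≤ ∑ i ∈ Finset.range (l + 1), 4096 * 2 ^ i := by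
          refine Finset.sum_le_sum fun i _ => ?_
          have := Circuit.steps_diffCircuit_le true η₁ (2 ^ i)
          omega
        have h4 : ∑ i ∈ Finset.range (l + 1), 2 ^ i < 2 ^ (l + 1) :=
          Nat.geomSum_lt le_rfl fun i hi => Finset.mem_range.1 hi
        rw [show ∑ i ∈ Finset.range (l + 1), 4096 * 2 ^ i
          = 4096 * ∑ i ∈ Finset.range (l + 1), 2 ^ i from (Finset.mul_sum _ _ _).symm] at h3
        have h5 : ∑ i ∈ Finset.range (l + 1),
            2048 * (Circuit.diffCircuit true η₁ (2 ^ i)).steps ≤ 8192 * 2 ^ l := by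
          rw [pow_succ] at h4; omega
        exact_mod_cast h5
      have h3 := steps_estimator_le (η := η l) (l := l) (L := L + 1) hκ1 hε hε1.le
      have h4 : 2 * (2 : ℝ) ^ (L + 1) ≤ 16 / c / ε ^ 2 := by
        calc 2 * (2 : ℝ) ^ (L + 1) = 4 * 2 ^ L := by ring
          _ ≤ 4 * (4 / (c * ε)) := by gcongr
          _ = 16 / c / ε := by field_simp; norm_num
          _ ≤ 16 / c / ε ^ 2 := by
            have : ε ^ 2 ≤ ε := by nlinarith
            gcongr
      have h5 : 8192 ≤ 8192 / ε ^ 2 := by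
        rw [le_div_iff₀ (by positivity)]; nlinarith
      rw [Nat.cast_add]
      calc _ ≤ 8192 * 2 ^ l + 2 ^ l * (8 * κ / ε ^ 2 + 2 * 2 ^ (L + 1)) := add_le_add h2 h3
        _ = 2 ^ l * (8192 + 8 * κ / ε ^ 2 + 2 * 2 ^ (L + 1)) := by ring
        _ ≤ (2 ^ 15 * X) * (8192 / ε ^ 2 + 8 * κ / ε ^ 2 + 16 / c / ε ^ 2) := by gcongr
        _ = _ := by ring
  obtain ⟨n, hn⟩ := QAlgorithm.exists_le_value_search (by norm_num) (by norm_num) hK ham hm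
  refine ⟨n, le_trans ?_ hn⟩
  -- `(15/16)² - 64/1024 = 209/256 > 2/3`.
  linarith
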